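/- Let $d,M$ be natural numbers, let $A_0,\dots,A_{M-1}$ be real $d\times d$ matrices and put $A=\sum_i A_i$. Let $K\subseteq\mathbb{R}^d$ be a closed cone with $K\neq\{0\}$; that is, $K$ is closed and convex, $\lambda K=K$ for all $\lambda>0$, and $K\cap(-K)=\{0\}$. Suppose that $A_iK\subseteq K$ for every $i$, that $A$ is $K$-irreducible, i.e. $\sum_{k=0}^{d-1}A^k$ maps $K\setminus\{0\}$ into the interior of $K$, and that $A\neq 0$. Let $\rho(A)$ be the spectral radius of $A$, and let $\sigma$ be the left shift on $\Sigma^{\mathbb{Z}}$, $\Sigma=\{0,\dots,M-1\}$. A $1$-Gibbs state for $(A_0,\dots,A_{M-1})$ is a $\sigma$-invariant Borel probability measure $\nu$ on $\Sigma^{\mathbb{Z}}$ for which there are $C>0$ and $P\in\mathbb{R}$ with $$C^{-1}\nu[x_0\cdots x_{n-1}]\le e^{-nP}\|A_{x_0}\cdots A_{x_{n-1}}\|\le C\,\nu[x_0\cdots x_{n-1}]$$ for all $n\ge 1$ and all words $x_0\cdots x_{n-1}$, where $[x_0\cdots x_{n-1}]$ is the set of sequences in $\Sigma^{\mathbb{Z}}$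 that have $x_0,\dots,x_{n-1}$ at the places $0,\dots,n-1$. Then there are $u,v\in\mathbb{R}^d$ with $Au=\rho(A)u$, $A^{T}v=\rho(A)v$ and $\langle u,v\rangle=1$, and there is a probability measure $\mu$ on $\Sigma^{\mathbb{Z}}$ such that, for all such $u,v$, all $n\geq 0$ and all words, $$\mu[x_0\cdots x_{n-1}]=\rho(A)^{-n}\langle A_{x_0}\cdots A_{x_{n-1}}u,v\rangle .$$ Moreover: 1. $\mu$ is a $1$-Gibbs state with $P=\log\rho(A)$; it is ergodic; it is the only $1$-Gibbs state; and $P=\log\rho(A)$ is the only constant with which the Gibbs inequality can hold. 2. If in addition $A$ is $K$-primitive, i.e. some power $A^N$ maps $K\setminus\{0\}$ into the interior of $K$, then (a) $\mu$ is weak Bernoulli: with $\mathcal{P}=\{[i]:i\in\Sigma\}$, for every $\varepsilon>0$ there is $N$ such that for all $r,s\ge 0$ and all $t\ge s+N$ $$\sum_{Q,R}|\mu(Q\cap R)-\mu(Q)\mu(R)|<\varepsilon,$$ where $Q$ runs over the cells of $\bigvee_{i=0}^{s-1}\sigma^{-i}\mathcal{P}$ and $R$ over those of $\bigvee_{i=t}^{t+r-1}\sigma^{-i}\mathcal{P}$;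 (b) $\mu$ has exponential decay of correlations for Hölder functions: for every $\theta\in(0,1)$ there are a constant $D$ and a $\gamma\in(0,1)$ such that $$\Big|\int f\cdot g\circ\sigma^{n}\,d\mu-\int f\,d\mu\int g\,d\mu\Big|\le D\,\|f\|_\theta\|g\|_\theta\,\gamma^{n}$$ for all $n\ge0$ and all $f,g\in\mathcal{H}_\theta$. Here $\mathcal{H}_\theta$ is the space of continuous $f:\Sigma^{\mathbb{Z}}\to\mathbb{R}$ for which there is a constant $L\geq 0$ with $\sup\{|f(x)-f(y)|:x_i=y_i\text{ for all }|i|\le n-1\}\le L\theta^n$ for all $n\ge0$, and $\|f\|_\theta=\|f\|_\infty+|f|_\theta$ with $|f|_\theta$ the least such $L$. The rate $\gamma$ is determined by $\theta$ and the eigenvalues of $A$: there is one function $\Gamma$ such that $\gamma=\Gamma(\theta,\{\text{complex eigenvalues of }A\})$ can be taken for all $d$, $M$, $A_0,\dots,A_{M-1}$, $K$ and $\theta$ as above. -/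

import Mathlib

open MeasureTheory

namespace MatrixGibbs

noncomputable section

/-! ### Cones and matrices acting on them -/

/-- A (pointed, convex) cone in `ℝ^d`. -/
structure IsCone {d : ℕ} (K : Set (Fin d → ℝ)) : Prop where
  inter_neg : K ∩ {x | -x ∈ K} = {0}
  smul_eq : ∀ c : ℝ, 0 < c → (fun x => c • x) '' K = K
  convex : Convex ℝ K

/-- `B` is `K`-non-negative: `B K ⊆ K`. -/
def KNonneg {d : ℕ} (K : Set (Fin d → ℝ)) (B : Matrix (Fin d) (Fin d) ℝ) : Prop :=
  ∀ x ∈ K, B.mulVec x ∈ K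

/-- `B` is `K`-positive: `B (K \ {0}) ⊆ interior K`. -/
def KPositive {d : ℕ} (K : Set (Fin d → ℝ)) (B : Matrix (Fin d) (Fin d) ℝ) : Prop :=
  ∀ x ∈ K, x ≠ 0 → B.mulVec x ∈ interior K

/-- `B` is `K`-irreducible: `B` is `K`-non-negative and `∑_{k=0}^{d-1} B^k` is `K`-positive. -/
def KIrreducible {d : ℕ} (K : Set (Fin d → ℝ)) (B : Matrix (Fin d) (Fin d) ℝ) : Prop :=
  KNonneg K B ∧ KPositive K (∑ k ∈ Finset.range d, B ^ k)

/-- `B` is `K`-primitive: `B` is `K`-non-negative and some power of `B` is `K`-positive. -/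
def KPrimitive {d : ℕ} (K : Set (Fin d → ℝ)) (B : Matrix (Fin d) (Fin d) ℝ) : Prop :=
  KNonneg K B ∧ ∃ N : ℕ, KPositive K (B ^ N)

/-- The set of complex eigenvalues of a real matrix. -/
def eigenvalues {d : ℕ} (B : Matrix (Fin d) (Fin d) ℝ) : Set ℂ :=
  spectrum ℂ (B.map Complex.ofReal)

/-- The spectral radius of a real matrix: the largest modulus of a complex eigenvalue. -/
def specRad {d : ℕ} (B : Matrix (Fin d) (Fin d) ℝ) : ℝ :=
  (spectralRadius ℂ (B.map Complex.ofReal)).toReal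

/-- The Euclidean operator norm of a matrix. -/
def opNorm {d : ℕ} (B : Matrix (Fin d) (Fin d) ℝ) : ℝ :=
  ‖Matrix.toEuclideanCLM (n := Fin d) (𝕜 := ℝ) B‖

/-- `A_w = A_{w_0} A_{w_1} ⋯ A_{w_{n-1}}` for a word `w` of length `n`. -/
def wordProd {d M n : ℕ} (A : Fin M → Matrix (Fin d) (Fin d) ℝ) (w : Fin n → Fin M) :
    Matrix (Fin d) (Fin d) ℝ :=
  (List.ofFn fun j => A (w j)).prod

/-- `(u, v)` is a pair of right and left eigenvectors of `B` for the spectral radius of `B`,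
normalised by `⟨u, v⟩ = 1`. -/
def IsPerronPair {d : ℕ} (B : Matrix (Fin d) (Fin d) ℝ) (u v : Fin d → ℝ) : Prop :=
  B.mulVec u = specRad B • u ∧ B.transpose.mulVec v = specRad B • v ∧ u ⬝ᵥ v = 1

/-! ### The two-sided full shift and matrix Gibbs states -/

/-- The left shift on `{0, …, M-1}^ℤ`. -/
def shift {M : ℕ} (x : ℤ → Fin M) : ℤ → Fin M := fun i => x (i + 1)

/-- The cylinder `[w_0 ⋯ w_{n-1}]`, the set of `x` with `x_j = w_j` for `0 ≤ j < n`. -/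
def wordCylinder {M n : ℕ} (w : Fin n → Fin M) : Set (ℤ → Fin M) :=
  {x | ∀ j : Fin n, x (j : ℤ) = w j}

/-- `μ` is a `t`-Gibbs state for `A` with the constant `P`: a shift-invariant probability measure
satisfying the Gibbs inequality for some `C > 0`. -/
def IsGibbsStateWith {d M : ℕ} (A : Fin M → Matrix (Fin d) (Fin d) ℝ) (t P : ℝ)
    (μ : Measure (ℤ → Fin M)) : Prop :=
  IsProbabilityMeasure μ ∧ MeasurePreserving shift μ μ ∧
    ∃ C : ℝ, 0 < C ∧ ∀ n : ℕ, 0 < n → ∀ w : Fin n → Fin M,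
      C⁻¹ * μ.real (wordCylinder w) ≤ Real.exp (-(n * P)) * opNorm (wordProd A w) ^ t ∧
      Real.exp (-(n * P)) * opNorm (wordProd A w) ^ t ≤ C * μ.real (wordCylinder w)

/-! ### The weak Bernoulli property -/

/-- Two finite partitions (given as indexed families of cells) are `ε`-independent. -/
def EpsIndependent {X ι κ : Type*} [MeasurableSpace X] [Fintype ι] [Fintype κ]
    (μ : Measure X) (ε : ℝ) (Q : ι → Set X) (R : κ → Set X) : Prop :=
  ∑ i, ∑ j, |μ.real (Q i ∩ R j) - μ.real (Q i) * μ.real (R j)| < ε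

/-- The cells of the join `⋁_{i=a}^{a+n-1} T^{-i} Pt`, indexed by the words of length `n`
(some of the cells may be empty). -/
def joinPartition {X ι : Type*} (T : X → X) (Pt : ι → Set X) (a n : ℕ) :
    (Fin n → ι) → Set X :=
  fun w => ⋂ j : Fin n, T^[a + (j : ℕ)] ⁻¹' Pt (w j)

/-- The partition `Pt` is weak Bernoulli for `T` and `μ`. -/
def IsWeakBernoulliPartition {X ι : Type*} [MeasurableSpace X] [Fintype ι]
    (T : X → X) (μ : Measure X) (Pt : ι → Set X) : Prop :=
  ∀ ε : ℝ, 0 < ε → ∃ N : ℕ, ∀ r s t : ℕ, s + N ≤ t →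
    EpsIndependent μ ε (joinPartition T Pt 0 s) (joinPartition T Pt t r)

/-- `μ` is weak Bernoulli: the standard partition `{[i] : 0 ≤ i ≤ M-1}` is weak Bernoulli. -/
def IsWeakBernoulli {M : ℕ} (μ : Measure (ℤ → Fin M)) : Prop :=
  IsWeakBernoulliPartition shift μ (fun i : Fin M => {x : ℤ → Fin M | x 0 = i})

/-! ### Hölder functions -/

/-- `var_n f = sup {|f x - f y| : x_i = y_i for all |i| ≤ n - 1}`. -/
def variation {M : ℕ} (f : C(ℤ → Fin M, ℝ)) (n : ℕ) : ℝ :=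
  sSup {a | ∃ x y : ℤ → Fin M, (∀ i : ℤ, |i| ≤ (n : ℤ) - 1 → x i = y i) ∧ a = |f x - f y|}

/-- The constants `L` that are admissible in `var_n f ≤ L θ^n`, for all `n`. -/
def holderConstants {M : ℕ} (θ : ℝ) (f : C(ℤ → Fin M, ℝ)) : Set ℝ :=
  {L | 0 ≤ L ∧ ∀ n : ℕ, variation f n ≤ L * θ ^ n}

/-- The space `H_θ`. -/
def IsHolder {M : ℕ} (θ : ℝ) (f : C(ℤ → Fin M, ℝ)) : Prop :=
  (holderConstants θ f).Nonempty

/-- The norm `‖f‖_θ = ‖f‖_∞ + |f|_θ`, where `|f|_θ` is the least admissible constant. -/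
def holderNorm {M : ℕ} (θ : ℝ) (f : C(ℤ → Fin M, ℝ)) : ℝ :=
  ‖f‖ + sInf (holderConstants θ f)

/-- Correlations of functions in `H_θ` decay exponentially with rate `γ`. -/
def HasDecayOfCorrelations {M : ℕ} (μ : Measure (ℤ → Fin M)) (θ γ : ℝ) : Prop :=
  ∃ D : ℝ, ∀ f g : C(ℤ → Fin M, ℝ), IsHolder θ f → IsHolder θ g → ∀ n : ℕ,
    |∫ x, f x * g (shift^[n] x) ∂μ - (∫ x, f x ∂μ) * ∫ x, g x ∂μ| ≤
      D * holderNorm θ f * holderNorm θ g * γ ^ n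

end

end MatrixGibbs

open MatrixGibbs

/-! A Perron–Frobenius theory for cones (`KIrreducible.exists_perron`) gives the total matrix an
eigenvalue r > 0, a right eigenvector u in the interior of K and a left eigenvector v that is
strictly positive on K. Divide all matrices by r and write N for their sum. Then Nu = u and Nᵀv = v
say that the weights ⟨N_w u, v⟩ of words w are consistent when a letter is summed out at either end.
They are non-negative because the products preserve K, so they are the cylinder measures of a
shift-invariant probability measure (`exists_measure_box`).

Two facts give the properties of this measure. First, u is an order unit and v dominates the norm on
K, so ‖T‖ is comparable to ⟨Tu, v⟩ for every T preserving K (`exists_opNorm_comparison`); this is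
the Gibbs inequality. Second, if two cylinders are separated by g free places, their joint measure
contains the factor N^g (`HasBoxWeights.inter_cylinderAt`), so mixing amounts to convergence of N^g
to the projection x ↦ ⟨x, v⟩u.

In the irreducible case the eigenvalue is simple and the Cesàro means of the powers converge
(`tendsto_cesaro`), which yields ergodicity. In the primitive case there is a spectral gap and the
powers converge exponentially, at a rate read off from the eigenvalues (`exists_pow_sub_le`); this
gives the weak Bernoulli property and, by truncation, the decay of Hölder correlations. Both
spectral statements rest on `exists_contraction`: a K-positive matrix contracts the kernel of v
strictly faster than its Perron eigenvalue.

For uniqueness, two Gibbs states are compared with the same sums of norms, so their constants P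
agree. Their cylinder measures are then comparable, so one is absolutely continuous with respect to
the other, ergodic one, and equals it (`IsGibbsStateWith.eq_of_ergodic`). -/

namespace MatrixGibbs

open Set Filter Topology Matrix
open scoped Pointwise

variable {d : ℕ} {K : Set (Fin d → ℝ)} {B : Matrix (Fin d) (Fin d) ℝ}

/-! ### Elementary properties of cones -/

namespace IsCone

lemma zero_mem (hK : IsCone K) : (0 : Fin d → ℝ) ∈ K := by
  have : (0 : Fin d → ℝ) ∈ K ∩ {x | -x ∈ K} := by rw [hK.inter_neg]; rfl
  exact this.1

lemma smul_mem (hK : IsCone K) {c : ℝ} (hc : 0 ≤ c) {x : Fin d → ℝ} (hx : x ∈ K) :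
    c • x ∈ K := by
  rcases hc.eq_or_lt with rfl | hc
  · simpa using hK.zero_mem
  · rw [← hK.smul_eq c hc]; exact ⟨x, hx, rfl⟩

lemma add_mem (hK : IsCone K) {x y : Fin d → ℝ} (hx : x ∈ K) (hy : y ∈ K) : x + y ∈ K := by
  have h := hK.convex hx hy (a := 1 / 2) (b := 1 / 2) (by norm_num) (by norm_num) (by norm_num)
  have h2 := hK.smul_mem (c := 2) (by norm_num) h
  rwa [smul_add, smul_smul, smul_smul, show (2 : ℝ) * (1 / 2) = 1 by norm_num, one_smul,
    one_smul] at h2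

lemma eq_zero (hK : IsCone K) {x : Fin d → ℝ} (hx : x ∈ K) (hx' : -x ∈ K) : x = 0 := by
  have : x ∈ K ∩ {x | -x ∈ K} := ⟨hx, hx'⟩
  rwa [hK.inter_neg] at this

lemma smul_interior (hK : IsCone K) {c : ℝ} (hc : 0 < c) {x : Fin d → ℝ} (hx : x ∈ interior K) :
    c • x ∈ interior K := by
  have h : c • x ∈ c • interior K := smul_mem_smul_set hx
  rw [← interior_smul₀ hc.ne'] at h
  have : c • K = K := hK.smul_eq c hc
  rwa [this] at h

/-- An interior point of a cone is an order unit. -/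
lemma exists_orderUnit (hK : IsCone K) {u : Fin d → ℝ} (hu : u ∈ interior K) :
    ∃ C : ℝ, 0 < C ∧ ∀ x, (C * ‖x‖) • u + x ∈ K := by
  obtain ⟨ε, hε, hb⟩ := Metric.isOpen_iff.1 isOpen_interior u hu
  refine ⟨2 / ε, by positivity, fun x => ?_⟩
  by_cases hx : x = 0
  · simpa [hx] using hK.zero_mem
  have hx' : 0 < ‖x‖ := norm_pos_iff.2 hx
  have hmem : u + (2 / ε * ‖x‖)⁻¹ • x ∈ K := by
    refine interior_subset (hb ?_)
    rw [Metric.mem_ball, dist_eq_norm, add_sub_cancel_left, norm_smul, norm_inv, norm_mul,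
      norm_norm, Real.norm_of_nonneg (by positivity)]
    field_simp
    linarith
  have := hK.smul_mem (c := 2 / ε * ‖x‖) (by positivity) hmem
  rwa [smul_add, smul_smul, mul_inv_cancel₀ (by positivity), one_smul] at this

lemma exists_ne_zero (hK : IsCone K) (h : K ≠ {0}) : ∃ x ∈ K, x ≠ 0 := by
  by_contra! hcon
  exact h (Subset.antisymm (fun x hx => hcon x hx) (by simpa using hK.zero_mem))

/-- If 0 were an order unit, every vector would lie in K, against pointedness. -/
lemma zero_notMem_interior (hK : IsCone K) (h : K ≠ {0}) : (0 : Fin d → ℝ) ∉ interior K := by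
  intro h0
  obtain ⟨x, hx, hne⟩ := hK.exists_ne_zero h
  obtain ⟨C, -, hC⟩ := hK.exists_orderUnit h0
  exact hne (hK.eq_zero hx (by simpa using hC (-x)))

end IsCone

/-! ### Duality: strictly positive functionals and the dual cone -/

/-- The dual cone of `K`. -/
def dualCone (K : Set (Fin d → ℝ)) : Set (Fin d → ℝ) := {w | ∀ x ∈ K, 0 ≤ x ⬝ᵥ w}

/-- `w` is strictly positive on `K \ {0}`. -/
def StrictlyPositiveOn (K : Set (Fin d → ℝ)) (w : Fin d → ℝ) : Prop :=
  ∀ x ∈ K, x ≠ 0 → 0 < x ⬝ᵥ w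

lemma continuous_dotProduct_left (w : Fin d → ℝ) : Continuous fun x : Fin d → ℝ => x ⬝ᵥ w := by
  simp only [dotProduct]; fun_prop

lemma continuous_dotProduct_right (x : Fin d → ℝ) : Continuous fun w : Fin d → ℝ => x ⬝ᵥ w := by
  simp only [dotProduct]; fun_prop

lemma StrictlyPositiveOn.nonneg {w : Fin d → ℝ} (h : StrictlyPositiveOn K w) {x : Fin d → ℝ}
    (hx : x ∈ K) : 0 ≤ x ⬝ᵥ w := by
  by_cases h0 : x = 0
  · simp [h0]
  · exact (h x hx h0).le

lemma StrictlyPositiveOn.mem_dualCone {w : Fin d → ℝ} (h : StrictlyPositiveOn K w) :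
    w ∈ dualCone K := fun _ hx => h.nonneg hx

lemma abs_dotProduct_le (x w : Fin d → ℝ) : |x ⬝ᵥ w| ≤ d * ‖x‖ * ‖w‖ := by
  calc |x ⬝ᵥ w| ≤ ∑ i, |x i * w i| := Finset.abs_sum_le_sum_abs _ _
    _ ≤ ∑ _i : Fin d, ‖x‖ * ‖w‖ := by
        refine Finset.sum_le_sum fun i _ => ?_
        rw [abs_mul]
        exact mul_le_mul (norm_le_pi_norm x i) (norm_le_pi_norm w i) (abs_nonneg _) (norm_nonneg _)
    _ = d * ‖x‖ * ‖w‖ := by simp [mul_assoc]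

lemma isCompact_inter_sphere (hcl : IsClosed K) : IsCompact (K ∩ Metric.sphere 0 1) :=
  (isCompact_sphere _ _).inter_left hcl

/-- A point outside a closed cone is separated from it by an element of the dual cone. -/
lemma exists_dualCone_neg (hK : IsCone K) (hcl : IsClosed K) {x : Fin d → ℝ} (hx : x ∉ K) :
    ∃ w ∈ dualCone K, x ⬝ᵥ w < 0 := by
  obtain ⟨f, c, hfx, hf⟩ := geometric_hahn_banach_point_closed hK.convex hcl hx
  have hc : c < 0 := by simpa using hf 0 hK.zero_mem
  have key : ∀ y : Fin d → ℝ, y ⬝ᵥ (fun i => f (Pi.single i 1)) = f y := by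
    intro y
    have := LinearMap.pi_apply_eq_sum_univ (f : (Fin d → ℝ) →ₗ[ℝ] ℝ) y
    simp only [ContinuousLinearMap.coe_coe, smul_eq_mul] at this
    rw [this, dotProduct]
    refine Finset.sum_congr rfl fun i _ => ?_
    congr 2
    ext j
    simp [Pi.single_apply, eq_comm]
  refine ⟨fun i => f (Pi.single i 1), fun y hy => ?_, ?_⟩
  · rw [key]
    by_contra! hneg
    -- If f were negative at y, a positive multiple of y would have the value c exactly, while f > c
    -- on K.
    have h1 := hf _ (hK.smul_mem (c := c / f y) (div_nonneg_of_nonpos hc.le hneg.le) hy)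
    rw [map_smul, smul_eq_mul, div_mul_cancel₀ _ hneg.ne] at h1
    exact lt_irrefl _ h1
  · rw [key]; linarith

/-- A closed cone admits a strictly positive functional. -/
lemma exists_strictlyPositiveOn (hK : IsCone K) (hcl : IsClosed K) :
    ∃ w, StrictlyPositiveOn K w := by
  have h : ∃ w ∈ dualCone K, ∀ x ∈ K ∩ Metric.sphere 0 1, 0 < x ⬝ᵥ w := by
    -- By pointedness −x is outside K, and separating it from K gives a dual element positive near
    -- x. By compactness finitely many of these suffice, and their sum is positive everywhere.
    refine (isCompact_inter_sphere hcl).induction_on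
      (p := fun s => ∃ w ∈ dualCone K, ∀ x ∈ s ∩ K, 0 < x ⬝ᵥ w) ?_ ?_ ?_ ?_ |>.imp ?_
    · exact ⟨0, fun x _ => by simp, by simp⟩
    · rintro s t hst ⟨w, hw, h⟩
      exact ⟨w, hw, fun x hx => h x ⟨hst hx.1, hx.2⟩⟩
    · rintro s t ⟨w, hw, h⟩ ⟨w', hw', h'⟩
      refine ⟨w + w', fun x hx => ?_, ?_⟩
      · rw [dotProduct_add]; exact add_nonneg (hw x hx) (hw' x hx)
      · rintro x ⟨hx | hx, hxK⟩ <;> rw [dotProduct_add]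
        · exact add_pos_of_pos_of_nonneg (h x ⟨hx, hxK⟩) (hw' x hxK)
        · exact add_pos_of_nonneg_of_pos (hw x hxK) (h' x ⟨hx, hxK⟩)
    · intro x hx
      have hneg : -x ∉ K := fun h => by
        have := hK.eq_zero hx.1 h
        simpa [this] using hx.2
      obtain ⟨w, hw, hlt⟩ := exists_dualCone_neg hK hcl hneg
      rw [neg_dotProduct, neg_lt_zero] at hlt
      refine ⟨{y | 0 < y ⬝ᵥ w}, mem_nhdsWithin_of_mem_nhds
        ((isOpen_lt continuous_const (continuous_dotProduct_left w)).mem_nhds hlt), w, hw,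
        fun y hy => hy.1⟩
    · rintro w ⟨hw, h⟩
      exact ⟨hw, fun x hx => h x ⟨hx, hx.1⟩⟩
  obtain ⟨w, -, hpos⟩ := h
  refine ⟨w, fun x hx hne => ?_⟩
  have hn : 0 < ‖x‖ := norm_pos_iff.2 hne
  have := hpos (‖x‖⁻¹ • x) ⟨hK.smul_mem (by positivity) hx, by simp [norm_smul, hn.ne']⟩
  rw [smul_dotProduct, smul_eq_mul] at this
  exact pos_of_mul_pos_right this (by positivity)

/-- A strictly positive functional dominates the norm on the cone. -/
lemma StrictlyPositiveOn.exists_norm_le {w : Fin d → ℝ} (h : StrictlyPositiveOn K w)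
    (hK : IsCone K) (hcl : IsClosed K) : ∃ C : ℝ, 0 < C ∧ ∀ x ∈ K, ‖x‖ ≤ C * (x ⬝ᵥ w) := by
  have hs : ∃ c : ℝ, 0 < c ∧ ∀ x ∈ K ∩ Metric.sphere 0 1, c ≤ x ⬝ᵥ w := by
    rcases (K ∩ Metric.sphere (0 : Fin d → ℝ) 1).eq_empty_or_nonempty with he | hne
    · exact ⟨1, one_pos, by simp [he]⟩
    obtain ⟨x, hx, hmin⟩ := (isCompact_inter_sphere hcl).exists_isMinOn hne
      (continuous_dotProduct_left w).continuousOn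
    refine ⟨x ⬝ᵥ w, h x hx.1 ?_, hmin⟩
    rintro rfl
    simpa using hx.2
  obtain ⟨c, hc, hcx⟩ := hs
  refine ⟨c⁻¹, by positivity, fun x hx => ?_⟩
  by_cases h0 : x = 0
  · simp [h0]
  have hn : 0 < ‖x‖ := norm_pos_iff.2 h0
  have := hcx (‖x‖⁻¹ • x) ⟨hK.smul_mem (by positivity) hx, by simp [norm_smul, hn.ne']⟩
  rw [smul_dotProduct, smul_eq_mul] at this
  field_simp at this ⊢
  linarith

/-- The margin C⁻¹‖x‖ ≤ ⟨x, w⟩ on K absorbs every small perturbation of w, uniformly in x. -/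
lemma StrictlyPositiveOn.mem_interior_dualCone {w : Fin d → ℝ} (h : StrictlyPositiveOn K w)
    (hK : IsCone K) (hcl : IsClosed K) : w ∈ interior (dualCone K) := by
  obtain ⟨C, hC, hle⟩ := h.exists_norm_le hK hcl
  rw [mem_interior_iff_mem_nhds, Metric.mem_nhds_iff]
  refine ⟨(C * (d + 1))⁻¹, by positivity, fun w' hw' x hx => ?_⟩
  rw [Metric.mem_ball, dist_eq_norm] at hw'
  have h1 := (abs_le.1 (abs_dotProduct_le x (w' - w))).1
  rw [dotProduct_sub] at h1
  have h2 : d * ‖x‖ * ‖w' - w‖ ≤ (d + 1) * ‖x‖ * (C * (d + 1))⁻¹ := by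
    gcongr
    linarith
  have h3 : (d + 1) * ‖x‖ * (C * (d + 1))⁻¹ = C⁻¹ * ‖x‖ := by field_simp
  have h4 : C⁻¹ * ‖x‖ ≤ x ⬝ᵥ w := by
    rw [inv_mul_le_iff₀ hC]; exact hle x hx
  linarith

/-- As x is an order unit, C‖w‖x − w lies in K; pairing it with w gives C‖w‖⟨x, w⟩ ≥ ⟨w, w⟩ > 0. -/
lemma dotProduct_pos_of_mem_interior (hK : IsCone K) {x w : Fin d → ℝ} (hx : x ∈ interior K)
    (hw : w ∈ dualCone K) (hne : w ≠ 0) : 0 < x ⬝ᵥ w := by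
  obtain ⟨C, hC, h⟩ := hK.exists_orderUnit hx
  have h1 := hw _ (h (-w))
  rw [add_dotProduct, smul_dotProduct, neg_dotProduct, norm_neg, smul_eq_mul] at h1
  have h2 : 0 < w ⬝ᵥ w := by
    have h0 : 0 ≤ w ⬝ᵥ w := Finset.sum_nonneg fun i _ => mul_self_nonneg _
    exact lt_of_le_of_ne h0 fun h => hne (dotProduct_self_eq_zero.1 h.symm)
  exact pos_of_mul_pos_right (lt_of_lt_of_le h2 (by linarith))
    (mul_nonneg hC.le (norm_nonneg w))

lemma isClosed_dualCone (K : Set (Fin d → ℝ)) : IsClosed (dualCone K) := by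
  have : dualCone K = ⋂ x ∈ K, {w | 0 ≤ x ⬝ᵥ w} := by ext; simp [dualCone]
  rw [this]
  exact isClosed_biInter fun x _ => isClosed_le continuous_const (continuous_dotProduct_right x)

/-- The interior point serves pointedness: it is strictly positive on nonzero dual elements, so w
and −w cannot both be dual unless w = 0. -/
lemma isCone_dualCone (hK : IsCone K) {u : Fin d → ℝ} (hu : u ∈ interior K) :
    IsCone (dualCone K) where
  inter_neg := by
    refine Subset.antisymm ?_ ?_
    · rintro w ⟨hw, hw'⟩
      by_contra hne
      have h1 := dotProduct_pos_of_mem_interior hK hu hw hne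
      have h2 := hw' u (interior_subset hu)
      rw [dotProduct_neg] at h2
      linarith
    · rintro _ rfl
      exact ⟨fun x _ => by simp, fun x _ => by simp⟩
  smul_eq := by
    intro c hc
    refine Subset.antisymm ?_ ?_
    · rintro _ ⟨w, hw, rfl⟩ x hx
      rw [dotProduct_smul]
      exact mul_nonneg hc.le (hw x hx)
    · intro w hw
      refine ⟨c⁻¹ • w, fun x hx => ?_, by simp [smul_smul, hc.ne']⟩
      rw [dotProduct_smul]
      exact mul_nonneg (by positivity) (hw x hx)
  convex := by
    intro w hw w' hw' a b ha hb _ x hx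
    rw [dotProduct_add, dotProduct_smul, dotProduct_smul]
    exact add_nonneg (mul_nonneg ha (hw x hx)) (mul_nonneg hb (hw' x hx))

lemma dotProduct_transpose_mulVec {R : Type*} [CommRing R] (B : Matrix (Fin d) (Fin d) R)
    (x w : Fin d → R) :
    x ⬝ᵥ (Bᵀ *ᵥ w) = (B *ᵥ x) ⬝ᵥ w := by
  rw [mulVec_transpose, dotProduct_comm, ← dotProduct_mulVec, dotProduct_comm]

lemma KNonneg.transpose (h : KNonneg K B) : KNonneg (dualCone K) Bᵀ := by
  intro w hw x hx
  rw [dotProduct_transpose_mulVec]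
  exact hw _ (h x hx)

lemma KPositive.transpose (hK : IsCone K) (hcl : IsClosed K) (h : KPositive K B) :
    KPositive (dualCone K) Bᵀ := by
  intro w hw hne
  refine StrictlyPositiveOn.mem_interior_dualCone (fun x hx hx0 => ?_) hK hcl
  rw [dotProduct_transpose_mulVec]
  exact dotProduct_pos_of_mem_interior hK (h x hx hx0) hw hne

/-- This lets the existence of an eigenvector be applied to the dual cone, which is where the left
eigenvector comes from. -/
lemma KIrreducible.transpose (hK : IsCone K) (hcl : IsClosed K) (h : KIrreducible K B) :
    KIrreducible (dualCone K) Bᵀ := by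
  refine ⟨h.1.transpose, ?_⟩
  have := h.2.transpose hK hcl
  rwa [transpose_sum, Finset.sum_congr rfl fun k _ => transpose_pow B k] at this

lemma KNonneg.pow (h : KNonneg K B) (n : ℕ) : KNonneg K (B ^ n) := by
  induction n with
  | zero => intro x hx; simpa using hx
  | succ n ih => intro x hx; rw [pow_succ, ← mulVec_mulVec]; exact ih _ (h x hx)

lemma pow_mulVec_eq {c : ℝ} {u : Fin d → ℝ} (h : B *ᵥ u = c • u) (n : ℕ) :
    (B ^ n) *ᵥ u = c ^ n • u := by
  induction n with
  | zero => simp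
  | succ n ih => rw [pow_succ, ← mulVec_mulVec, h, mulVec_smul, ih, smul_smul, pow_succ']

lemma sum_pow_mulVec_eq {c : ℝ} {u : Fin d → ℝ} (h : B *ᵥ u = c • u) (n : ℕ) :
    (∑ k ∈ Finset.range n, B ^ k) *ᵥ u = (∑ k ∈ Finset.range n, c ^ k) • u := by
  rw [sum_mulVec, Finset.sum_smul]
  exact Finset.sum_congr rfl fun k _ => pow_mulVec_eq h k

lemma exists_norm_mulVec_le (B : Matrix (Fin d) (Fin d) ℝ) :
    ∃ C : ℝ, 0 < C ∧ ∀ x, ‖B *ᵥ x‖ ≤ C * ‖x‖ := by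
  obtain ⟨C, hC, h⟩ := (LinearMap.toContinuousLinearMap (toLin' B)).bound
  exact ⟨C, hC, fun x => by simpa using h x⟩

/-! ### The Perron–Frobenius theorem for cones -/

/-- An irreducible matrix has a non-negative eigenvalue with an eigenvector in the interior. -/
lemma KIrreducible.exists_eigenvector (hK : IsCone K) (hcl : IsClosed K) (hne : K ≠ {0})
    (hB : KIrreducible K B) : ∃ r : ℝ, 0 ≤ r ∧ ∃ u ∈ interior K, B *ᵥ u = r • u := by
  obtain ⟨w, hw⟩ := exists_strictlyPositiveOn hK hcl
  obtain ⟨C, hC, hle⟩ := hw.exists_norm_le hK hcl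
  obtain ⟨L, hL, hBL⟩ := exists_norm_mulVec_le B
  have hBc : Continuous fun x : Fin d → ℝ => B *ᵥ x :=
    Continuous.matrix_mulVec continuous_const continuous_id
  -- Collatz–Wielandt: maximise t over unit vectors x in K with tx ≤ Bx in the order of K. A
  -- strictly positive functional bounds t, so the set is compact.
  set S : Set (ℝ × (Fin d → ℝ)) :=
    {p | 0 ≤ p.1 ∧ p.2 ∈ K ∧ ‖p.2‖ = 1 ∧ B *ᵥ p.2 - p.1 • p.2 ∈ K} with hS
  have hScl : IsClosed S := by
    refine (isClosed_le continuous_const continuous_fst).inter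
      ((hcl.preimage continuous_snd).inter
        ((isClosed_eq continuous_snd.norm continuous_const).inter (hcl.preimage ?_)))
    exact (hBc.comp continuous_snd).sub (continuous_fst.smul continuous_snd)
  have hSsub : S ⊆ Icc 0 (C * (d * L * ‖w‖)) ×ˢ Metric.sphere 0 1 := by
    rintro ⟨t, x⟩ ⟨h0, h1, h2, h3⟩
    refine ⟨⟨h0, ?_⟩, by simpa using h2⟩
    have h4 := hw.nonneg h3
    simp only [sub_dotProduct, smul_dotProduct, smul_eq_mul] at h4
    have h5 := hle x h1
    simp only at h2 h0
    rw [h2] at h5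
    have h6 : (B *ᵥ x) ⬝ᵥ w ≤ d * L * ‖w‖ := by
      refine (le_abs_self _).trans ((abs_dotProduct_le _ _).trans ?_)
      have := hBL x
      rw [h2, mul_one] at this
      gcongr
    calc t = t * 1 := (mul_one t).symm
      _ ≤ t * (C * (x ⬝ᵥ w)) := by gcongr
      _ = C * (t * (x ⬝ᵥ w)) := by ring
      _ ≤ C * (d * L * ‖w‖) := mul_le_mul_of_nonneg_left (by linarith) hC.le
  have hSc : IsCompact S :=
    (isCompact_Icc.prod (isCompact_sphere _ _)).of_isClosed_subset hScl hSsub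
  obtain ⟨x₀, hx₀, hx₀n⟩ := hK.exists_ne_zero hne
  have hnorm : ∀ x : Fin d → ℝ, x ≠ 0 → ‖‖x‖⁻¹ • x‖ = 1 := fun x hx => by
    simp [norm_smul, norm_ne_zero_iff.2 hx]
  have hSne : S.Nonempty := by
    have hmem : ‖x₀‖⁻¹ • x₀ ∈ K := hK.smul_mem (by positivity) hx₀
    exact ⟨(0, ‖x₀‖⁻¹ • x₀), le_rfl, hmem, hnorm _ hx₀n, by simpa using hB.1 _ hmem⟩
  obtain ⟨⟨t, x⟩, ⟨ht, hxK, hx1, hdiff⟩, hmax⟩ :=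
    hSc.exists_isMaxOn hSne continuous_fst.continuousOn
  simp only at ht hxK hx1 hdiff
  have hxne : x ≠ 0 := by rintro rfl; simp at hx1
  set T := ∑ k ∈ Finset.range d, B ^ k with hT
  have hcomm : ∀ y : Fin d → ℝ, T *ᵥ (B *ᵥ y) = B *ᵥ (T *ᵥ y) := fun y => by
    have : T * B = B * T := by
      rw [hT, Finset.sum_mul, Finset.mul_sum]
      exact Finset.sum_congr rfl fun k _ => by rw [← pow_succ, pow_succ']
    rw [mulVec_mulVec, mulVec_mulVec, this]
  have heig : B *ᵥ x = t • x := by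
    by_contra hcon
    have hint : T *ᵥ (B *ᵥ x - t • x) ∈ interior K :=
      hB.2 _ hdiff (sub_ne_zero.2 hcon)
    rw [mulVec_sub, mulVec_smul, hcomm] at hint
    have hzint : T *ᵥ x ∈ interior K := hB.2 _ hxK hxne
    set z := T *ᵥ x
    have hz0 : z ≠ 0 := fun h => hK.zero_notMem_interior hne (h ▸ hzint)
    obtain ⟨D, hD, hDx⟩ := hK.exists_orderUnit hint
    have hzn : 0 < ‖z‖ := norm_pos_iff.2 hz0
    have h1 := hK.smul_mem (c := (D * ‖z‖)⁻¹) (by positivity) (hDx (-z))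
    rw [norm_neg, smul_add, smul_smul, inv_mul_cancel₀ (by positivity), one_smul] at h1
    have hmem : (t + (D * ‖z‖)⁻¹, ‖z‖⁻¹ • z) ∈ S := by
      refine ⟨by positivity, hK.smul_mem (by positivity) (interior_subset hzint), hnorm _ hz0, ?_⟩
      have h2 := hK.smul_mem (c := ‖z‖⁻¹) (by positivity) h1
      convert h2 using 1
      simp only [mulVec_smul]
      module
    have h3 : t + (D * ‖z‖)⁻¹ ≤ t := hmax hmem
    have : 0 < (D * ‖z‖)⁻¹ := by positivity
    linarith
  refine ⟨t, ht, x, ?_, heig⟩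
  -- Now Tx is a positive multiple of x, so x is itself interior.
  have h1 : T *ᵥ x ∈ interior K := hB.2 _ hxK hxne
  rw [sum_pow_mulVec_eq heig] at h1
  have hd : 0 < d := by
    rcases Nat.eq_zero_or_pos d with rfl | h
    · exact absurd (Subsingleton.elim x 0) hxne
    · exact h
  have hpos : 0 < ∑ k ∈ Finset.range d, t ^ k :=
    Finset.sum_pos' (fun k _ => by positivity) ⟨0, by simpa using hd, by simp⟩
  have := hK.smul_interior (inv_pos.2 hpos) h1
  rwa [smul_smul, inv_mul_cancel₀ hpos.ne', one_smul] at this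

/-- A cone-preserving matrix that annihilates an interior point vanishes. -/
lemma KNonneg.eq_zero_of_mulVec_eq_zero (hK : IsCone K) (hB : KNonneg K B) {u : Fin d → ℝ}
    (hu : u ∈ interior K) (h : B *ᵥ u = 0) : B = 0 := by
  obtain ⟨C, hC, hCx⟩ := hK.exists_orderUnit hu
  have key : ∀ x, B *ᵥ x ∈ K := fun x => by
    have := hB _ (hCx x)
    rwa [mulVec_add, mulVec_smul, h, smul_zero, zero_add] at this
  have : ∀ x, B *ᵥ x = 0 := fun x => hK.eq_zero (key x) (by simpa [mulVec_neg] using key (-x))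
  exact ext_of_mulVec_single fun i => by rw [this, zero_mulVec]

/-- Existence of the Perron eigenvalue with its right and left eigenvectors. -/
lemma KIrreducible.exists_perron (hK : IsCone K) (hcl : IsClosed K) (hne : K ≠ {0})
    (hB : KIrreducible K B) (hB0 : B ≠ 0) :
    ∃ r : ℝ, 0 < r ∧ ∃ u ∈ interior K, ∃ v, StrictlyPositiveOn K v ∧
      B *ᵥ u = r • u ∧ Bᵀ *ᵥ v = r • v ∧ u ⬝ᵥ v = 1 := by
  obtain ⟨r, hr, u, hu, hBu⟩ := hB.exists_eigenvector hK hcl hne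
  have hr0 : 0 < r := by
    refine lt_of_le_of_ne hr fun h => hB0 (hB.1.eq_zero_of_mulVec_eq_zero hK hu ?_)
    rw [hBu, ← h, zero_smul]
  have hu0 : u ≠ 0 := fun h => hK.zero_notMem_interior hne (h ▸ hu)
  obtain ⟨w, hw⟩ := exists_strictlyPositiveOn hK hcl
  have hdual := isCone_dualCone hK hu
  have hdne : dualCone K ≠ {0} := fun h => by
    have hw0 : w = 0 := by simpa [h] using hw.mem_dualCone
    have := hw u (interior_subset hu) hu0
    simp [hw0] at this
  obtain ⟨s, -, v, hv, hBv⟩ :=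
    (hB.transpose hK hcl).exists_eigenvector hdual (isClosed_dualCone K) hdne
  have hv0 : v ≠ 0 := fun h => hdual.zero_notMem_interior hdne (h ▸ hv)
  have huv : 0 < u ⬝ᵥ v := dotProduct_pos_of_mem_interior hK hu (interior_subset hv) hv0
  -- Evaluating ⟨u, Bᵀv⟩ = ⟨Bu, v⟩ identifies the two eigenvalues, since ⟨u, v⟩ > 0.
  have hsr : s = r := by
    have h1 := dotProduct_transpose_mulVec B u v
    rw [hBv, hBu, dotProduct_smul, smul_dotProduct, smul_eq_mul, smul_eq_mul] at h1
    exact mul_right_cancel₀ huv.ne' h1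
  subst hsr
  -- A multiple of v minus the strictly positive w is still dual, so v dominates a strictly positive
  -- functional.
  have hvpos : StrictlyPositiveOn K v := by
    obtain ⟨C, hC, hCx⟩ := hdual.exists_orderUnit hv
    intro x hx hx0
    have h1 := hCx (-w) x hx
    rw [dotProduct_add, dotProduct_smul, dotProduct_neg, smul_eq_mul] at h1
    have h2 := hw x hx hx0
    exact pos_of_mul_pos_right (lt_of_lt_of_le h2 (by linarith : _ ≤ C * ‖-w‖ * x ⬝ᵥ v))
      (by positivity)
  refine ⟨s, hr0, u, hu, (u ⬝ᵥ v)⁻¹ • v, ?_, hBu, ?_, ?_⟩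
  · intro x hx hx0
    rw [dotProduct_smul]
    exact mul_pos (inv_pos.2 huv) (hvpos x hx hx0)
  · rw [mulVec_smul, hBv, smul_comm]
  · rw [dotProduct_smul, smul_eq_mul, inv_mul_cancel₀ huv.ne']

end MatrixGibbs

namespace MatrixGibbs

open Set Filter Topology Matrix

variable {d : ℕ} {K : Set (Fin d → ℝ)} {B : Matrix (Fin d) (Fin d) ℝ} {r : ℝ} {u v : Fin d → ℝ}

/-! ### Norm bounds and contraction transverse to the Perron vector -/

/-- A cone-preserving matrix with its Perron eigenvalue and normalised eigenvectors. -/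
structure PerronData (K : Set (Fin d → ℝ)) (B : Matrix (Fin d) (Fin d) ℝ) (r : ℝ)
    (u v : Fin d → ℝ) : Prop where
  isCone : IsCone K
  isClosed : IsClosed K
  nonneg : KNonneg K B
  mem_interior : u ∈ interior K
  pos : StrictlyPositiveOn K v
  right : B *ᵥ u = r • u
  left : Bᵀ *ᵥ v = r • v
  inner : u ⬝ᵥ v = 1

/-- The norm of a cone-preserving matrix is controlled by a single matrix coefficient. -/
lemma exists_norm_mulVec_le_coeff (hK : IsCone K) (hcl : IsClosed K) (hu : u ∈ interior K)
    (hv : StrictlyPositiveOn K v) :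
    ∃ C : ℝ, 0 < C ∧ ∀ T, KNonneg K T → ∀ x, ‖T *ᵥ x‖ ≤ C * ((T *ᵥ u) ⬝ᵥ v) * ‖x‖ := by
  obtain ⟨C₁, hC₁, h₁⟩ := hv.exists_norm_le hK hcl
  obtain ⟨C₂, hC₂, h₂⟩ := hK.exists_orderUnit hu
  -- Both su ± x lie in K for s = C₂‖x‖, so ⟨Tx, v⟩ is at most s⟨Tu, v⟩. The factor 3 counts two
  -- such terms from T(su + x) and one from subtracting sTu.
  refine ⟨3 * C₁ * C₂, by positivity, fun T hT x => ?_⟩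
  set s := C₂ * ‖x‖ with hs
  have hs0 : 0 ≤ s := by positivity
  set q := (T *ᵥ u) ⬝ᵥ v with hq
  have hmem : T *ᵥ (s • u + x) ∈ K := hT _ (h₂ x)
  have hmem' : T *ᵥ (s • u - x) ∈ K := hT _ (by simpa [sub_eq_add_neg] using h₂ (-x))
  have e1 := h₁ _ hmem
  have e2 := hv.nonneg hmem'
  have e3 := h₁ _ (hT u (interior_subset hu))
  rw [mulVec_add, mulVec_smul, add_dotProduct, smul_dotProduct, smul_eq_mul] at e1
  rw [mulVec_sub, mulVec_smul, sub_dotProduct, smul_dotProduct, smul_eq_mul] at e2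
  have e4 : ‖T *ᵥ x‖ ≤ ‖s • T *ᵥ u + T *ᵥ x‖ + s * ‖T *ᵥ u‖ := by
    have := norm_sub_le (s • T *ᵥ u + T *ᵥ x) (s • T *ᵥ u)
    rwa [add_sub_cancel_left, norm_smul, Real.norm_of_nonneg hs0] at this
  calc ‖T *ᵥ x‖ ≤ C₁ * (s * q + (T *ᵥ x) ⬝ᵥ v) + s * (C₁ * q) :=
        e4.trans (add_le_add e1 (mul_le_mul_of_nonneg_left e3 hs0))
    _ ≤ C₁ * (s * q + s * q) + s * (C₁ * q) := by
        gcongr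
        linarith
    _ = 3 * C₁ * C₂ * q * ‖x‖ := by rw [hs]; ring

namespace PerronData

lemma pow (h : PerronData K B r u v) (n : ℕ) : PerronData K (B ^ n) (r ^ n) u v where
  isCone := h.isCone
  isClosed := h.isClosed
  nonneg := h.nonneg.pow n
  mem_interior := h.mem_interior
  pos := h.pos
  right := pow_mulVec_eq h.right n
  left := by rw [transpose_pow]; exact pow_mulVec_eq h.left n
  inner := h.inner

lemma smul (h : PerronData K B r u v) {c : ℝ} (hc : 0 ≤ c) :
    PerronData K (c • B) (c * r) u v where
  isCone := h.isCone
  isClosed := h.isClosed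
  nonneg := fun x hx => by rw [smul_mulVec]; exact h.isCone.smul_mem hc (h.nonneg x hx)
  mem_interior := h.mem_interior
  pos := h.pos
  right := by rw [smul_mulVec, h.right, smul_smul]
  left := by rw [transpose_smul, smul_mulVec, h.left, smul_smul]
  inner := h.inner

lemma sum_pow (h : PerronData K B r u v) (n : ℕ) :
    PerronData K (∑ k ∈ Finset.range n, B ^ k) (∑ k ∈ Finset.range n, r ^ k) u v where
  isCone := h.isCone
  isClosed := h.isClosed
  nonneg := fun x hx => by
    rw [sum_mulVec]
    exact Finset.sum_induction _ (· ∈ K) (fun _ _ => h.isCone.add_mem) h.isCone.zero_mem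
      fun k _ => h.nonneg.pow k x hx
  mem_interior := h.mem_interior
  pos := h.pos
  right := sum_pow_mulVec_eq h.right n
  left := by
    rw [transpose_sum, Finset.sum_congr rfl fun k _ => transpose_pow B k]
    exact sum_pow_mulVec_eq h.left n
  inner := h.inner

lemma dotProduct_mulVec (h : PerronData K B r u v) (x : Fin d → ℝ) :
    (B *ᵥ x) ⬝ᵥ v = r * (x ⬝ᵥ v) := by
  rw [← dotProduct_transpose_mulVec, h.left, dotProduct_smul, smul_eq_mul]

lemma ne_zero (h : PerronData K B r u v) : u ≠ 0 := by
  rintro rfl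
  simpa using h.inner

lemma exists_norm_pow_le (h : PerronData K B r u v) :
    ∃ C : ℝ, 0 < C ∧ ∀ (n : ℕ) (x : Fin d → ℝ), ‖(B ^ n) *ᵥ x‖ ≤ C * r ^ n * ‖x‖ := by
  obtain ⟨C, hC, hle⟩ := exists_norm_mulVec_le_coeff h.isCone h.isClosed h.mem_interior h.pos
  refine ⟨C, hC, fun n x => ?_⟩
  have := hle _ (h.nonneg.pow n) x
  rwa [(h.pow n).right, smul_dotProduct, h.inner, smul_eq_mul, mul_one] at this

/-- A cone-positive matrix contracts the complement of its Perron eigenvector at a strictly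
smaller exponential rate. -/
lemma exists_contraction (h : PerronData K B r u v) (hpos : KPositive K B) :
    ∃ c C : ℝ, 0 ≤ c ∧ c < r ∧ 0 < C ∧
      ∀ (n : ℕ) (x : Fin d → ℝ), x ⬝ᵥ v = 0 → ‖(B ^ n) *ᵥ x‖ ≤ C * c ^ n * ‖x‖ := by
  obtain ⟨C₁, hC₁, h₁⟩ := h.pos.exists_norm_le h.isCone h.isClosed
  have hBc : Continuous fun x : Fin d → ℝ => B *ᵥ x :=
    Continuous.matrix_mulVec continuous_const continuous_id
  set S := {x ∈ K | x ⬝ᵥ v = 1} with hS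
  have hSc : IsCompact S := by
    refine (isCompact_closedBall (0 : Fin d → ℝ) C₁).of_isClosed_subset
      (h.isClosed.inter (isClosed_eq (continuous_dotProduct_left v) continuous_const)) ?_
    rintro x ⟨hx, hx1⟩
    have := h₁ x hx
    rw [hx1, mul_one] at this
    simpa using this
  -- The image of the compact slice ⟨x, v⟩ = 1 keeps a margin δ inside the interior, so subtracting
  -- ε⟨x, v⟩u from Bx stays in K for ε = δ / ‖u‖.
  obtain ⟨δ, hδ, hsub⟩ := (hSc.image hBc).exists_cthickening_subset_open isOpen_interior (by
    rintro _ ⟨x, hx, rfl⟩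
    refine hpos x hx.1 ?_
    rintro rfl
    simpa using hx.2)
  have hun : 0 < ‖u‖ := norm_pos_iff.2 h.ne_zero
  set ε := δ / ‖u‖ with hε
  have hε0 : 0 < ε := by positivity
  have hmem : ∀ x ∈ K, B *ᵥ x - (ε * (x ⬝ᵥ v)) • u ∈ K := by
    intro x hx
    by_cases hx0 : x = 0
    · simpa [hx0] using h.isCone.zero_mem
    have hxv := h.pos x hx hx0
    have h2 : (x ⬝ᵥ v)⁻¹ • x ∈ S :=
      ⟨h.isCone.smul_mem (by positivity) hx, by
        rw [smul_dotProduct, smul_eq_mul, inv_mul_cancel₀ hxv.ne']⟩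
    have h3 : B *ᵥ ((x ⬝ᵥ v)⁻¹ • x) - ε • u ∈ K := by
      refine interior_subset (hsub (Metric.mem_cthickening_of_dist_le _ _ _ _ ⟨_, h2, rfl⟩ ?_))
      rw [dist_eq_norm, sub_sub_cancel_left, norm_neg, norm_smul, Real.norm_of_nonneg hε0.le, hε,
        div_mul_cancel₀ _ hun.ne']
    have h4 := h.isCone.smul_mem hxv.le h3
    rwa [mulVec_smul, smul_sub, smul_smul, smul_smul, mul_inv_cancel₀ hxv.ne', one_smul,
      mul_comm (x ⬝ᵥ v)] at h4
  -- This rank-one deflation still preserves K, lowers the Perron eigenvalue to r − ε, and has the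
  -- same powers as B on vectors annihilated by v.
  set T := B - ε • vecMulVec u v with hT
  have hTx : ∀ x, T *ᵥ x = B *ᵥ x - (ε * (x ⬝ᵥ v)) • u := by
    intro x
    rw [hT, sub_mulVec, smul_mulVec, vecMulVec_mulVec, dotProduct_comm]
    ext i
    simp
    ring
  have hTK : KNonneg K T := fun x hx => by rw [hTx]; exact hmem x hx
  have hTu : T *ᵥ u = (r - ε) • u := by
    rw [hTx, h.right, h.inner, mul_one, sub_smul]
  have hc0 : 0 ≤ r - ε := by
    have := h.pos.nonneg (hTK u (interior_subset h.mem_interior))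
    rwa [hTu, smul_dotProduct, h.inner, smul_eq_mul, mul_one] at this
  obtain ⟨C, hC, hle⟩ := exists_norm_mulVec_le_coeff h.isCone h.isClosed h.mem_interior h.pos
  refine ⟨r - ε, C, hc0, by linarith, hC, fun n x hx => ?_⟩
  have hpow : ∀ n : ℕ, (T ^ n) *ᵥ x = (B ^ n) *ᵥ x := by
    intro n
    induction n with
    | zero => simp
    | succ n ih =>
      rw [pow_succ', ← mulVec_mulVec, ih, hTx, (h.pow n).dotProduct_mulVec, hx, mul_zero, mul_zero,
        zero_smul, sub_zero, mulVec_mulVec, ← pow_succ']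
  have := hle _ (hTK.pow n) x
  rwa [pow_mulVec_eq hTu, smul_dotProduct, h.inner, smul_eq_mul, mul_one, hpow] at this

end PerronData

/-! ### Complex eigenvalues -/

/-- The complexification of a real vector. -/
def complexify (x : Fin d → ℝ) : Fin d → ℂ := fun i => x i

lemma map_mulVec_complexify (B : Matrix (Fin d) (Fin d) ℝ) (x : Fin d → ℝ) :
    B.map Complex.ofReal *ᵥ complexify x = complexify (B *ᵥ x) := by
  ext i
  exact (RingHom.map_mulVec Complex.ofRealHom B x i).symm

lemma complexify_smul (c : ℝ) (x : Fin d → ℝ) : complexify (c • x) = (c : ℂ) • complexify x := by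
  ext i; simp [complexify]

lemma complexify_dotProduct (x y : Fin d → ℝ) :
    complexify x ⬝ᵥ complexify y = ((x ⬝ᵥ y : ℝ) : ℂ) := by
  simp [complexify, dotProduct]

/-- The real part of a complex vector. -/
def rePart (z : Fin d → ℂ) : Fin d → ℝ := fun i => (z i).re

/-- The imaginary part of a complex vector. -/
def imPart (z : Fin d → ℂ) : Fin d → ℝ := fun i => (z i).im

lemma rePart_map_mulVec (B : Matrix (Fin d) (Fin d) ℝ) (z : Fin d → ℂ) :
    rePart (B.map Complex.ofReal *ᵥ z) = B *ᵥ rePart z := by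
  ext i; simp [rePart, mulVec, dotProduct]

lemma imPart_map_mulVec (B : Matrix (Fin d) (Fin d) ℝ) (z : Fin d → ℂ) :
    imPart (B.map Complex.ofReal *ᵥ z) = B *ᵥ imPart z := by
  ext i; simp [imPart, mulVec, dotProduct]

lemma rePart_dotProduct (z : Fin d → ℂ) (y : Fin d → ℝ) :
    rePart z ⬝ᵥ y = (z ⬝ᵥ complexify y).re := by
  simp [rePart, complexify, dotProduct]

lemma imPart_dotProduct (z : Fin d → ℂ) (y : Fin d → ℝ) :
    imPart z ⬝ᵥ y = (z ⬝ᵥ complexify y).im := by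
  simp [imPart, complexify, dotProduct]

lemma norm_le_rePart_add_imPart (z : Fin d → ℂ) : ‖z‖ ≤ ‖rePart z‖ + ‖imPart z‖ := by
  refine (pi_norm_le_iff_of_nonneg (by positivity)).2 fun i => ?_
  exact (Complex.norm_le_abs_re_add_abs_im (z i)).trans
    (add_le_add (norm_le_pi_norm (rePart z) i) (norm_le_pi_norm (imPart z) i))

lemma map_ofReal_pow (B : Matrix (Fin d) (Fin d) ℝ) (n : ℕ) :
    (B ^ n).map Complex.ofReal = B.map Complex.ofReal ^ n :=
  map_pow (Complex.ofRealHom.mapMatrix (m := Fin d)) B n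

lemma mapC_pow_mulVec_eq {T : Matrix (Fin d) (Fin d) ℂ} {η : ℂ} {z : Fin d → ℂ}
    (h : T *ᵥ z = η • z) (n : ℕ) : (T ^ n) *ᵥ z = η ^ n • z := by
  induction n with
  | zero => simp
  | succ n ih => rw [pow_succ, ← mulVec_mulVec, h, mulVec_smul, ih, smul_smul, pow_succ']

/-- A constant factor does not affect an exponential growth rate: if b < a, then C(b/a)^n would tend
to 0 while staying at least 1. -/
lemma le_of_forall_pow_le {a b C : ℝ} (hb : 0 ≤ b)
    (h : ∀ n : ℕ, a ^ n ≤ C * b ^ n) : a ≤ b := by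
  by_contra! hlt
  have ha0 : 0 < a := hb.trans_lt hlt
  have hlim : Tendsto (fun n : ℕ => C * (b / a) ^ n) atTop (𝓝 (C * 0)) :=
    (tendsto_pow_atTop_nhds_zero_of_lt_one (by positivity) ((div_lt_one ha0).2 hlt)).const_mul C
  have h1 : (1 : ℝ) ≤ C * 0 := ge_of_tendsto' hlim fun n => by
    rw [div_pow, ← mul_div_assoc, le_div_iff₀ (by positivity), one_mul]
    exact h n
  norm_num at h1

/-- Since B is real, its powers act separately on the real and imaginary parts of z; their growth
bounds that of η^n z. -/
lemma norm_eigenvalue_le {C c : ℝ} {η : ℂ} {z : Fin d → ℂ} (hc : 0 ≤ c) (hz : z ≠ 0)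
    (hBz : B.map Complex.ofReal *ᵥ z = η • z)
    (hre : ∀ n : ℕ, ‖(B ^ n) *ᵥ rePart z‖ ≤ C * c ^ n * ‖rePart z‖)
    (him : ∀ n : ℕ, ‖(B ^ n) *ᵥ imPart z‖ ≤ C * c ^ n * ‖imPart z‖) : ‖η‖ ≤ c := by
  have hzn : 0 < ‖z‖ := norm_pos_iff.2 hz
  refine le_of_forall_pow_le (C := C * (‖rePart z‖ + ‖imPart z‖) / ‖z‖) hc
    fun n => ?_
  have h1 := norm_le_rePart_add_imPart (η ^ n • z)
  rw [← mapC_pow_mulVec_eq hBz, ← map_ofReal_pow, rePart_map_mulVec, imPart_map_mulVec,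
    map_ofReal_pow, mapC_pow_mulVec_eq hBz, norm_smul, norm_pow] at h1
  have h2 := h1.trans (add_le_add (hre n) (him n))
  rw [div_mul_eq_mul_div, le_div_iff₀ hzn]
  linarith

lemma mem_eigenvalues_iff {η : ℂ} :
    η ∈ eigenvalues B ↔ ∃ z : Fin d → ℂ, z ≠ 0 ∧ B.map Complex.ofReal *ᵥ z = η • z := by
  rw [eigenvalues, ← spectrum_toLin', ← Module.End.hasEigenvalue_iff_mem_spectrum]
  constructor
  · intro h
    obtain ⟨z, hz⟩ := h.exists_hasEigenvector
    exact ⟨z, hz.2, by simpa using hz.apply_eq_smul⟩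
  · rintro ⟨z, hz, hBz⟩
    exact Module.End.hasEigenvalue_of_hasEigenvector
      (Module.End.hasEigenvector_iff.2 ⟨Module.End.mem_eigenspace_iff.2 (by simpa using hBz), hz⟩)

lemma finite_eigenvalues (B : Matrix (Fin d) (Fin d) ℝ) : (eigenvalues B).Finite :=
  Matrix.finite_spectrum _

namespace PerronData

lemma norm_le_of_mem_eigenvalues (h : PerronData K B r u v) (hr : 0 ≤ r) {η : ℂ}
    (hη : η ∈ eigenvalues B) : ‖η‖ ≤ r := by
  obtain ⟨z, hz, hBz⟩ := mem_eigenvalues_iff.1 hη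
  obtain ⟨C, -, hC⟩ := h.exists_norm_pow_le
  exact norm_eigenvalue_le hr hz hBz (fun n => hC n _) fun n => hC n _

lemma complexify_ne_zero (h : PerronData K B r u v) : complexify u ≠ 0 := fun h0 => by
  have := complexify_dotProduct u v
  rw [h0, zero_dotProduct, h.inner] at this
  simp at this

lemma mem_eigenvalues (h : PerronData K B r u v) : (r : ℂ) ∈ eigenvalues B :=
  mem_eigenvalues_iff.2 ⟨complexify u, h.complexify_ne_zero, by
    rw [map_mulVec_complexify, h.right, complexify_smul]⟩

lemma specRad_eq (h : PerronData K B r u v) (hr : 0 ≤ r) : specRad B = r := by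
  have : spectralRadius ℂ (B.map Complex.ofReal) = ENNReal.ofReal r := by
    apply le_antisymm
    · refine iSup₂_le fun η hη => ?_
      rw [← enorm_eq_nnnorm, ← ofReal_norm]
      exact ENNReal.ofReal_le_ofReal (h.norm_le_of_mem_eigenvalues hr hη)
    · have h1 : (‖(r : ℂ)‖₊ : ENNReal) ≤ spectralRadius ℂ (B.map Complex.ofReal) :=
        le_iSup₂_of_le (r : ℂ) h.mem_eigenvalues le_rfl
      refine le_trans (le_of_eq ?_) h1
      rw [← enorm_eq_nnnorm, ← ofReal_norm, Complex.norm_real, Real.norm_of_nonneg hr]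
  rw [specRad, this, ENNReal.toReal_ofReal hr]

lemma complex_dotProduct_mulVec (h : PerronData K B r u v) (z : Fin d → ℂ) :
    (B.map Complex.ofReal *ᵥ z) ⬝ᵥ complexify v = r * (z ⬝ᵥ complexify v) := by
  rw [← dotProduct_transpose_mulVec, ← transpose_map, map_mulVec_complexify, h.left,
    complexify_smul, dotProduct_smul, smul_eq_mul]

/-- Complex eigenvectors of a cone-positive matrix that are annihilated by the left Perron vector
have eigenvalues of strictly smaller modulus. -/
lemma norm_lt_of_positive (h : PerronData K B r u v) (hpos : KPositive K B) {η : ℂ}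
    {z : Fin d → ℂ} (hz : z ≠ 0) (hzv : z ⬝ᵥ complexify v = 0)
    (hBz : B.map Complex.ofReal *ᵥ z = η • z) : ‖η‖ < r := by
  obtain ⟨c, C, hc, hcr, -, hC⟩ := h.exists_contraction hpos
  refine (norm_eigenvalue_le hc hz hBz (fun n => hC n _ ?_) fun n => hC n _ ?_).trans_lt hcr
  · rw [rePart_dotProduct, hzv, Complex.zero_re]
  · rw [imPart_dotProduct, hzv, Complex.zero_im]

/-- Simplicity of the Perron eigenvalue. -/
lemma eq_zero_of_irreducible (h : PerronData K B r u v) (hr : 0 ≤ r) (hirr : KIrreducible K B)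
    {z : Fin d → ℂ} (hzv : z ⬝ᵥ complexify v = 0)
    (hBz : B.map Complex.ofReal *ᵥ z = (r : ℂ) • z) : z = 0 := by
  by_contra hz
  -- By irreducibility ∑ B^k is K-positive, with Perron eigenvalue ∑ r^k. A nonzero z would be an
  -- eigenvector for this very eigenvalue in the kernel of v, where only smaller moduli occur.
  have key : (∑ k ∈ Finset.range d, B ^ k).map Complex.ofReal *ᵥ z =
      ((∑ k ∈ Finset.range d, r ^ k : ℝ) : ℂ) • z := by
    have : (∑ k ∈ Finset.range d, B ^ k).map Complex.ofReal =
        ∑ k ∈ Finset.range d, B.map Complex.ofReal ^ k := by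
      have := map_sum (Complex.ofRealHom.mapMatrix (m := Fin d)) (fun k => B ^ k) (Finset.range d)
      simp only [map_pow] at this
      exact this
    rw [this, sum_mulVec, Complex.ofReal_sum, Finset.sum_smul]
    exact Finset.sum_congr rfl fun k _ => by rw [mapC_pow_mulVec_eq hBz, Complex.ofReal_pow]
  have := (h.sum_pow d).norm_lt_of_positive hirr.2 hz hzv key
  rw [Complex.norm_real, Real.norm_of_nonneg (Finset.sum_nonneg fun k _ => by positivity)] at this
  exact lt_irrefl _ this

/-- An eigenvector for an eigenvalue other than r is annihilated by v, and the contraction of the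
K-positive power B^N then applies to it. -/
lemma norm_lt_of_primitive (h : PerronData K B r u v) (hr : 0 ≤ r) (hprim : KPrimitive K B)
    {η : ℂ} (hη : η ∈ eigenvalues B) (hne : η ≠ r) : ‖η‖ < r := by
  obtain ⟨z, hz, hBz⟩ := mem_eigenvalues_iff.1 hη
  obtain ⟨-, N, hN⟩ := hprim
  have hzv : z ⬝ᵥ complexify v = 0 := by
    have := h.complex_dotProduct_mulVec z
    rw [hBz, smul_dotProduct, smul_eq_mul] at this
    have h0 : (η - r) * (z ⬝ᵥ complexify v) = 0 := by rw [sub_mul, this, sub_self]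
    exact (mul_eq_zero.1 h0).resolve_left (sub_ne_zero.2 hne)
  have := (h.pow N).norm_lt_of_positive hN hz hzv (η := η ^ N)
    (by rw [map_ofReal_pow, mapC_pow_mulVec_eq hBz])
  rw [norm_pow] at this
  exact lt_of_pow_lt_pow_left₀ N hr this

end PerronData

end MatrixGibbs

namespace MatrixGibbs

open Set Filter Topology Matrix

variable {d : ℕ} {K : Set (Fin d → ℝ)} {B : Matrix (Fin d) (Fin d) ℝ} {r : ℝ} {u v : Fin d → ℝ}

/-! ### The spectral gap and the convergence of powers -/

/-- The largest modulus of an element of `S`. -/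
noncomputable def topModulus (S : Set ℂ) : ℝ := sSup (norm '' S)

/-- The largest modulus of an element of `S` other than the largest modulus itself. -/
noncomputable def secondModulus (S : Set ℂ) : ℝ := sSup (norm '' (S \ {(topModulus S : ℂ)}))

/-- A number strictly between the second largest and the largest modulus, relative to the
latter. -/
noncomputable def mixingRate (S : Set ℂ) : ℝ :=
  (secondModulus S + topModulus S) / (2 * topModulus S)

lemma secondModulus_nonneg (S : Set ℂ) : 0 ≤ secondModulus S :=
  Real.sSup_nonneg (by rintro _ ⟨z, -, rfl⟩; exact norm_nonneg z)

namespace PerronData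

lemma topModulus_eq (h : PerronData K B r u v) (hr : 0 ≤ r) : topModulus (eigenvalues B) = r := by
  refine IsGreatest.csSup_eq ⟨⟨r, h.mem_eigenvalues, ?_⟩, ?_⟩
  · rw [Complex.norm_real, Real.norm_of_nonneg hr]
  · rintro _ ⟨η, hη, rfl⟩
    exact h.norm_le_of_mem_eigenvalues hr hη

lemma norm_le_secondModulus (h : PerronData K B r u v) (hr : 0 ≤ r) {η : ℂ}
    (hη : η ∈ eigenvalues B) (hne : η ≠ r) : ‖η‖ ≤ secondModulus (eigenvalues B) := by
  refine le_csSup (((finite_eigenvalues B).subset sdiff_subset).image _).bddAbove ?_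
  exact ⟨η, ⟨hη, by rwa [h.topModulus_eq hr]⟩, rfl⟩

lemma secondModulus_lt (h : PerronData K B r u v) (hr : 0 < r) (hprim : KPrimitive K B) :
    secondModulus (eigenvalues B) < r := by
  rw [secondModulus, h.topModulus_eq hr.le]
  have hfin : (norm '' (eigenvalues B \ {(r : ℂ)})).Finite :=
    ((finite_eigenvalues B).subset sdiff_subset).image _
  rcases (norm '' (eigenvalues B \ {(r : ℂ)})).eq_empty_or_nonempty with he | hne
  · rw [he, Real.sSup_empty]; exact hr
  · rw [hfin.csSup_lt_iff hne]
    rintro _ ⟨η, ⟨hη, hηr⟩, rfl⟩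
    exact h.norm_lt_of_primitive hr.le hprim hη hηr

lemma mixingRate_pos (h : PerronData K B r u v) (hr : 0 < r) : 0 < mixingRate (eigenvalues B) := by
  rw [mixingRate, h.topModulus_eq hr.le]
  have := secondModulus_nonneg (eigenvalues B)
  positivity

lemma mixingRate_lt_one (h : PerronData K B r u v) (hr : 0 < r) (hprim : KPrimitive K B) :
    mixingRate (eigenvalues B) < 1 := by
  rw [mixingRate, h.topModulus_eq hr.le, div_lt_one (by positivity)]
  linarith [h.secondModulus_lt hr hprim]

attribute [local instance] Matrix.linftyOpNormedRing Matrix.linftyOpNormedAlgebra in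
-- Deflate by r u vᵀ to get E. A nonzero eigenvalue of E has an eigenvector annihilated by v, so it
-- is an eigenvalue of B, and by simplicity it is not r. Gelfand's formula bounds the powers of E,
-- which agree with those of B on the kernel of v.
lemma exists_norm_pow_le_of_primitive (h : PerronData K B r u v) (hr : 0 < r)
    (hirr : KIrreducible K B) (hprim : KPrimitive K B) :
    ∃ D : ℝ, 0 < D ∧ ∀ (n : ℕ) (x : Fin d → ℝ), x ⬝ᵥ v = 0 →
      ‖(B ^ n) *ᵥ x‖ ≤ D * (mixingRate (eigenvalues B) * r) ^ n * ‖x‖ := by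
  set E : Matrix (Fin d) (Fin d) ℝ := B - r • vecMulVec u v with hE
  have hEx : ∀ z : Fin d → ℂ, E.map Complex.ofReal *ᵥ z =
      B.map Complex.ofReal *ᵥ z - (r * (z ⬝ᵥ complexify v)) • complexify u := by
    intro z
    have : E.map Complex.ofReal =
        B.map Complex.ofReal - (r : ℂ) • vecMulVec (complexify u) (complexify v) := by
      ext i j
      simp [hE, vecMulVec_apply, complexify]
    rw [this, sub_mulVec, smul_mulVec, vecMulVec_mulVec, dotProduct_comm z]
    ext i
    simp
    ring
  have hs0 := secondModulus_nonneg (eigenvalues B)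
  have hs1 := h.secondModulus_lt hr hprim
  set q := mixingRate (eigenvalues B) * r with hq
  -- The midpoint leaves room strictly above the spectral radius of E, as Gelfand's formula
  -- requires.
  have hqe : q = (secondModulus (eigenvalues B) + r) / 2 := by
    rw [hq, mixingRate, h.topModulus_eq hr.le]; field_simp
  have hq0 : 0 < q := mul_pos (h.mixingRate_pos hr) hr
  have hspec : ∀ η ∈ spectrum ℂ (E.map Complex.ofReal), ‖η‖₊ < q.toNNReal := by
    intro η hη
    rw [← NNReal.coe_lt_coe, coe_nnnorm, Real.coe_toNNReal _ hq0.le]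
    by_cases hη0 : η = 0
    · simpa [hη0] using hq0
    obtain ⟨z, hz, hEz⟩ := mem_eigenvalues_iff.1 hη
    have hzv : z ⬝ᵥ complexify v = 0 := by
      have h1 : (E.map Complex.ofReal *ᵥ z) ⬝ᵥ complexify v = 0 := by
        rw [hEx, sub_dotProduct, h.complex_dotProduct_mulVec, smul_dotProduct,
          complexify_dotProduct, h.inner]
        simp
      rw [hEz, smul_dotProduct, smul_eq_mul] at h1
      exact (mul_eq_zero.1 h1).resolve_left hη0
    rw [hEx, hzv, mul_zero, zero_smul, sub_zero] at hEz
    have hne : η ≠ r := by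
      rintro rfl
      exact hz (h.eq_zero_of_irreducible hr.le hirr hzv hEz)
    have := h.norm_le_secondModulus hr.le (mem_eigenvalues_iff.2 ⟨z, hz, hEz⟩) hne
    rw [hqe]
    linarith
  have hd : Nonempty (Fin d) := by
    by_contra hcon
    rw [not_nonempty_iff] at hcon
    exact h.ne_zero (Subsingleton.elim _ _)
  have hlt := spectrum.spectralRadius_lt_of_forall_lt (E.map Complex.ofReal) hspec
  have hlim := spectrum.pow_nnnorm_pow_one_div_tendsto_nhds_spectralRadius (E.map Complex.ofReal)
  have hev : ∀ᶠ n : ℕ in atTop, ‖E.map Complex.ofReal ^ n‖ ≤ q ^ n := by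
    filter_upwards [hlim.eventually_lt_const hlt, eventually_gt_atTop 0] with n hn hn0
    have h1 := ENNReal.rpow_le_rpow hn.le (z := (n : ℝ)) (by positivity)
    rw [← ENNReal.rpow_mul, one_div_mul_cancel (by positivity), ENNReal.rpow_one,
      ENNReal.rpow_natCast] at h1
    have h2 : ‖E.map Complex.ofReal ^ n‖₊ ≤ q.toNNReal ^ n := by exact_mod_cast h1
    have h3 : ((‖E.map Complex.ofReal ^ n‖₊ : NNReal) : ℝ) ≤ ((q.toNNReal ^ n : NNReal) : ℝ) := h2
    rwa [coe_nnnorm, NNReal.coe_pow, Real.coe_toNNReal _ hq0.le] at h3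
  obtain ⟨N, hN⟩ := eventually_atTop.1 hev
  obtain ⟨D, hD1, hD⟩ : ∃ D : ℝ, 1 ≤ D ∧ ∀ n, ‖E.map Complex.ofReal ^ n‖ ≤ D * q ^ n := by
    -- The sum covers the finitely many powers before the Gelfand bound sets in.
    refine ⟨1 + ∑ k ∈ Finset.range N, ‖E.map Complex.ofReal ^ k‖ / q ^ k,
      le_add_of_nonneg_right (Finset.sum_nonneg fun k _ => by positivity), fun n => ?_⟩
    rcases le_or_gt N n with hn | hn
    · refine (hN n hn).trans (le_mul_of_one_le_left (by positivity) ?_)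
      exact le_add_of_nonneg_right (Finset.sum_nonneg fun k _ => by positivity)
    · rw [← div_le_iff₀ (by positivity)]
      have := Finset.single_le_sum (f := fun k => ‖E.map Complex.ofReal ^ k‖ / q ^ k)
        (fun k _ => by positivity) (Finset.mem_range.2 hn)
      linarith
  refine ⟨D, by linarith, fun n x hx => ?_⟩
  have hpow : ∀ n : ℕ, (E.map Complex.ofReal ^ n) *ᵥ complexify x = complexify ((B ^ n) *ᵥ x) := by
    intro n
    induction n with
    | zero => simp
    | succ n ih =>
      rw [pow_succ', ← mulVec_mulVec, ih, hEx, complexify_dotProduct, (h.pow n).dotProduct_mulVec,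
        hx, map_mulVec_complexify, mulVec_mulVec, ← pow_succ', mul_zero, Complex.ofReal_zero,
        mul_zero, zero_smul, sub_zero]
  have hnorm : ∀ y : Fin d → ℝ, ‖complexify y‖ = ‖y‖ := fun y => by
    simp [complexify, Pi.norm_def]
  have := linfty_opNorm_mulVec (E.map Complex.ofReal ^ n) (complexify x)
  rw [hpow, hnorm, hnorm] at this
  exact this.trans (mul_le_mul_of_nonneg_right (hD n) (norm_nonneg x))

/-- Splitting off the Perron component. -/
lemma sub_dotProduct_eq_zero (h : PerronData K B r u v) (x : Fin d → ℝ) :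
    (x - (x ⬝ᵥ v) • u) ⬝ᵥ v = 0 := by
  rw [sub_dotProduct, smul_dotProduct, h.inner, smul_eq_mul, mul_one, sub_self]

lemma exists_norm_sub_le (u v : Fin d → ℝ) :
    ∃ C : ℝ, 0 < C ∧ ∀ x : Fin d → ℝ, ‖x - (x ⬝ᵥ v) • u‖ ≤ C * ‖x‖ := by
  refine ⟨1 + d * ‖v‖ * ‖u‖, by positivity, fun x => ?_⟩
  calc ‖x - (x ⬝ᵥ v) • u‖ ≤ ‖x‖ + |x ⬝ᵥ v| * ‖u‖ := by
        simpa [norm_smul] using norm_sub_le x ((x ⬝ᵥ v) • u)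
    _ ≤ ‖x‖ + d * ‖x‖ * ‖v‖ * ‖u‖ := by gcongr; exact abs_dotProduct_le x v
    _ = (1 + d * ‖v‖ * ‖u‖) * ‖x‖ := by ring

/-- Exponential convergence of the normalised powers of a primitive matrix. -/
lemma exists_pow_sub_le (h : PerronData K B r u v) (hr : 0 < r)
    (hirr : KIrreducible K B) (hprim : KPrimitive K B) :
    ∃ D : ℝ, 0 < D ∧ ∀ (n : ℕ) (x : Fin d → ℝ),
      ‖((r⁻¹ • B) ^ n) *ᵥ x - (x ⬝ᵥ v) • u‖ ≤ D * mixingRate (eigenvalues B) ^ n * ‖x‖ := by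
  obtain ⟨D, hD, hle⟩ := h.exists_norm_pow_le_of_primitive hr hirr hprim
  obtain ⟨C, hC, hCx⟩ := exists_norm_sub_le u v
  refine ⟨D * C, by positivity, fun n x => ?_⟩
  have hB := (h.smul (c := r⁻¹) (by positivity)).pow n
  rw [inv_mul_cancel₀ hr.ne', one_pow] at hB
  have h1 : ((r⁻¹ • B) ^ n) *ᵥ x - (x ⬝ᵥ v) • u =
      (r ^ n)⁻¹ • ((B ^ n) *ᵥ (x - (x ⬝ᵥ v) • u)) := by
    rw [← smul_mulVec, ← inv_pow, ← smul_pow, mulVec_sub, mulVec_smul, hB.right, one_smul]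
  have h0 := h.mixingRate_pos hr
  rw [h1, norm_smul, Real.norm_of_nonneg (by positivity), inv_mul_le_iff₀ (by positivity)]
  calc ‖(B ^ n) *ᵥ (x - (x ⬝ᵥ v) • u)‖
      ≤ D * (mixingRate (eigenvalues B) * r) ^ n * ‖x - (x ⬝ᵥ v) • u‖ :=
        hle n _ (h.sub_dotProduct_eq_zero x)
    _ ≤ D * (mixingRate (eigenvalues B) * r) ^ n * (C * ‖x‖) := by
        gcongr
        exact hCx x
    _ = r ^ n * (D * C * mixingRate (eigenvalues B) ^ n * ‖x‖) := by rw [mul_pow]; ring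

/-- Simplicity of the Perron eigenvalue on the real level. -/
lemma eq_zero_of_mulVec_eq (h : PerronData K B r u v) (hr : 0 ≤ r) (hirr : KIrreducible K B)
    {y : Fin d → ℝ} (hyv : y ⬝ᵥ v = 0) (hy : B *ᵥ y = r • y) : y = 0 := by
  have h3 : complexify y = 0 := h.eq_zero_of_irreducible hr hirr
    (by rw [complexify_dotProduct, hyv, Complex.ofReal_zero])
    (by rw [map_mulVec_complexify, hy, complexify_smul])
  ext i
  have := congrFun h3 i
  simpa [complexify] using this

lemma inv_smul (h : PerronData K B r u v) (hr : 0 < r) : PerronData K (r⁻¹ • B) 1 u v := by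
  have := h.smul (c := r⁻¹) (by positivity)
  rwa [inv_mul_cancel₀ hr.ne'] at this

/-- Convergence of the Cesàro averages of a normalised irreducible matrix. -/
lemma tendsto_cesaro (h : PerronData K B 1 u v)
    (hsimple : ∀ y, y ⬝ᵥ v = 0 → B *ᵥ y = y → y = 0) (x : Fin d → ℝ) :
    Tendsto (fun n : ℕ => (n : ℝ)⁻¹ • ∑ k ∈ Finset.range n, (B ^ k) *ᵥ x) atTop
      (𝓝 ((x ⬝ᵥ v) • u)) := by
  -- Simplicity makes L injective, hence surjective. So x minus its Perron component has the form By
  -- − y, and its sums along the powers telescope.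
  set L : (Fin d → ℝ) →ₗ[ℝ] (Fin d → ℝ) := toLin' (B - 1 + vecMulVec u v) with hL
  have hLx : ∀ y, L y = B *ᵥ y - y + (y ⬝ᵥ v) • u := fun y => by
    rw [hL, toLin'_apply, add_mulVec, sub_mulVec, one_mulVec, vecMulVec_mulVec, dotProduct_comm]
    ext i
    simp
  have hLv : ∀ y, L y ⬝ᵥ v = y ⬝ᵥ v := fun y => by
    rw [hLx, add_dotProduct, sub_dotProduct, h.dotProduct_mulVec, smul_dotProduct, h.inner]
    simp
  have hinj : Function.Injective L := by
    rw [← LinearMap.ker_eq_bot, LinearMap.ker_eq_bot']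
    intro y hy
    have h1 : y ⬝ᵥ v = 0 := by rw [← hLv, hy, zero_dotProduct]
    have h2 : B *ᵥ y = y := by
      have := hLx y
      rw [hy, h1, zero_smul, add_zero] at this
      exact (sub_eq_zero.1 this.symm)
    exact hsimple y h1 h2
  obtain ⟨y, hy⟩ := LinearMap.injective_iff_surjective.1 hinj (x - (x ⬝ᵥ v) • u)
  have hyv : y ⬝ᵥ v = 0 := by rw [← hLv, hy, h.sub_dotProduct_eq_zero]
  rw [hLx, hyv, zero_smul, add_zero] at hy
  have hx : x = (x ⬝ᵥ v) • u + (B *ᵥ y - y) := by rw [hy]; abel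
  obtain ⟨C, hC, hle⟩ := h.exists_norm_pow_le
  have hsum : ∀ n : ℕ, ∑ k ∈ Finset.range n, (B ^ k) *ᵥ x =
      (n : ℝ) • (x ⬝ᵥ v) • u + ((B ^ n) *ᵥ y - y) := by
    intro n
    have : ∀ k : ℕ, (B ^ k) *ᵥ x = (x ⬝ᵥ v) • u + ((B ^ (k + 1)) *ᵥ y - (B ^ k) *ᵥ y) := by
      intro k
      conv_lhs => rw [hx]
      rw [mulVec_add, mulVec_smul, (h.pow k).right, one_pow, one_smul, mulVec_sub, mulVec_mulVec,
        ← pow_succ]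
    rw [Finset.sum_congr rfl fun k _ => this k, Finset.sum_add_distrib,
      Finset.sum_range_sub (fun k => (B ^ k) *ᵥ y)]
    simp [← Nat.cast_smul_eq_nsmul ℝ]
  have hsmall : Tendsto (fun n : ℕ => (n : ℝ)⁻¹ • ((B ^ n) *ᵥ y - y)) atTop (𝓝 0) := by
    refine squeeze_zero_norm (a := fun n : ℕ => (n : ℝ)⁻¹ * (C * ‖y‖ + ‖y‖)) (fun n => ?_) ?_
    · rw [norm_smul, norm_inv, Real.norm_natCast]
      gcongr
      refine (norm_sub_le _ _).trans (add_le_add ?_ le_rfl)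
      simpa using hle n y
    · simpa using (tendsto_inv_atTop_nhds_zero_nat (𝕜 := ℝ)).mul_const (C * ‖y‖ + ‖y‖)
  have hmain : Tendsto (fun n : ℕ => (x ⬝ᵥ v) • u + (n : ℝ)⁻¹ • ((B ^ n) *ᵥ y - y)) atTop
      (𝓝 ((x ⬝ᵥ v) • u)) := by simpa using hsmall.const_add ((x ⬝ᵥ v) • u)
  refine hmain.congr' ?_
  filter_upwards [eventually_gt_atTop 0] with n hn
  rw [hsum, smul_add, smul_smul, inv_mul_cancel₀ (by positivity), one_smul]

/-- Convergence of the Cesàro averages of a normalised irreducible matrix. -/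
lemma tendsto_cesaro_of_irreducible (h : PerronData K B r u v) (hr : 0 < r)
    (hirr : KIrreducible K B) (x : Fin d → ℝ) :
    Tendsto (fun n : ℕ => (n : ℝ)⁻¹ • ∑ k ∈ Finset.range n, ((r⁻¹ • B) ^ k) *ᵥ x) atTop
      (𝓝 ((x ⬝ᵥ v) • u)) := by
  refine (h.inv_smul hr).tendsto_cesaro (fun y hyv hy => ?_) x
  refine h.eq_zero_of_mulVec_eq hr.le hirr hyv ?_
  rw [smul_mulVec, inv_smul_eq_iff₀ hr.ne'] at hy
  exact hy

/-- Matrix coefficients do not depend on the choice of the Perron pair. -/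
lemma perronPair_dotProduct (h : PerronData K B r u v) (hr : 0 < r) (hirr : KIrreducible K B)
    {u' v' : Fin d → ℝ} (hu : B *ᵥ u' = r • u') (hv : Bᵀ *ᵥ v' = r • v') (huv : u' ⬝ᵥ v' = 1)
    (T : Matrix (Fin d) (Fin d) ℝ) : (T *ᵥ u') ⬝ᵥ v' = (T *ᵥ u) ⬝ᵥ v := by
  have hu' : u' = (u' ⬝ᵥ v) • u := by
    rw [← sub_eq_zero]
    refine h.eq_zero_of_mulVec_eq hr.le hirr (h.sub_dotProduct_eq_zero u') ?_
    rw [mulVec_sub, mulVec_smul, hu, h.right, smul_sub, smul_comm]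
  -- Pairing with v' is invariant under r⁻¹B, so it can be evaluated at the Cesàro limit ⟨x, v⟩u;
  -- simplicity of the left eigenvector is not needed separately.
  have hv' : ∀ x : Fin d → ℝ, x ⬝ᵥ v' = (x ⬝ᵥ v) * (u ⬝ᵥ v') := by
    intro x
    have hstep : ∀ k : ℕ, (((r⁻¹ • B) ^ k) *ᵥ x) ⬝ᵥ v' = x ⬝ᵥ v' := by
      intro k
      have : (r⁻¹ • B)ᵀ *ᵥ v' = (1 : ℝ) • v' := by
        rw [transpose_smul, smul_mulVec, hv, smul_smul, inv_mul_cancel₀ hr.ne']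
      rw [← dotProduct_transpose_mulVec, transpose_pow, pow_mulVec_eq this, one_pow, one_smul]
    have h1 := ((continuous_dotProduct_left v').tendsto _).comp
      (h.tendsto_cesaro_of_irreducible hr hirr x)
    rw [smul_dotProduct, smul_eq_mul] at h1
    refine tendsto_nhds_unique (tendsto_const_nhds.congr' ?_) h1
    filter_upwards [eventually_gt_atTop 0] with n hn
    have : (n : ℝ) ≠ 0 := by positivity
    simp only [Function.comp_apply, smul_dotProduct, sum_dotProduct, hstep, Finset.sum_const,
      Finset.card_range, nsmul_eq_mul, smul_eq_mul]
    field_simp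
  have h1 : (u' ⬝ᵥ v) * (u ⬝ᵥ v') = 1 := by rw [← hv', huv]
  conv_lhs => rw [hu', mulVec_smul, smul_dotProduct, hv', smul_eq_mul]
  linear_combination ((T *ᵥ u) ⬝ᵥ v) * h1

end PerronData

end MatrixGibbs

namespace MatrixGibbs

open Set Filter Topology Matrix MeasureTheory

variable {d M : ℕ} {K : Set (Fin d → ℝ)} {N : Fin M → Matrix (Fin d) (Fin d) ℝ}
  {u v : Fin d → ℝ}

/-! ### Products along sequences of matrices -/

/-- The ordered product `c 0 * c 1 * ⋯ * c (n - 1)`. -/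
def seqProd {R : Type*} [Monoid R] (c : ℕ → R) (n : ℕ) : R :=
  (List.ofFn fun j : Fin n => c j).prod

section seqProd

variable {R : Type*} [Monoid R]

lemma seqProd_zero (c : ℕ → R) : seqProd c 0 = 1 := by simp [seqProd]

lemma seqProd_succ (c : ℕ → R) (n : ℕ) : seqProd c (n + 1) = seqProd c n * c n := by
  rw [seqProd, List.ofFn_succ_last]
  simp [seqProd]

lemma seqProd_add (c : ℕ → R) (m n : ℕ) :
    seqProd c (m + n) = seqProd c m * seqProd (fun j => c (m + j)) n := by
  induction n with
  | zero => simp [seqProd_zero]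
  | succ n ih => rw [← add_assoc, seqProd_succ, ih, seqProd_succ, mul_assoc]

lemma seqProd_congr {c c' : ℕ → R} {n : ℕ} (h : ∀ j < n, c j = c' j) :
    seqProd c n = seqProd c' n := by
  simp only [seqProd]
  congr 2
  ext j
  exact h j j.2

lemma seqProd_const (b : R) (n : ℕ) : seqProd (fun _ => b) n = b ^ n := by
  simp [seqProd]

end seqProd

/-- Noncommutative expansion of a product of sums. -/
lemma sum_prod_ofFn {R : Type*} [Semiring R] {n : ℕ} (C : Fin n → Fin M → R) :
    ∑ w : Fin n → Fin M, (List.ofFn fun j => C j (w j)).prod =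
      (List.ofFn fun j => ∑ i, C j i).prod := by
  induction n with
  | zero => simp
  | succ n ih =>
    rw [← (Fin.consEquiv fun _ => Fin M).sum_comp, Fintype.sum_prod_type]
    simp only [List.ofFn_succ, List.prod_cons, Fin.consEquiv_apply, Fin.cons_zero, Fin.cons_succ]
    rw [← ih (fun j => C j.succ), Finset.sum_mul]
    exact Finset.sum_congr rfl fun i _ => by rw [Finset.mul_sum]

/-- The sum of the matrices with index in `S`. -/
noncomputable def setSum (N : Fin M → Matrix (Fin d) (Fin d) ℝ) (S : Set (Fin M)) :
    Matrix (Fin d) (Fin d) ℝ := ∑ i, S.indicator N i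

lemma setSum_univ (N : Fin M → Matrix (Fin d) (Fin d) ℝ) : setSum N univ = ∑ i, N i := by
  simp [setSum]

lemma setSum_singleton (N : Fin M → Matrix (Fin d) (Fin d) ℝ) (i : Fin M) :
    setSum N {i} = N i := by
  classical
  rw [setSum, Finset.sum_eq_single i]
  · simp
  · intro j _ hj; simp [hj]
  · simp

/-! ### Rectangles -/

/-- The set of sequences whose coordinates in the window `[a, a + n)` lie in given sets. -/
def box (a : ℤ) (n : ℕ) (S : ℤ → Set (Fin M)) : Set (ℤ → Fin M) :=
  {x | ∀ i, a ≤ i → i < a + n → x i ∈ S i}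

/-- The matrix product attached to a rectangle. -/
noncomputable def boxProd (N : Fin M → Matrix (Fin d) (Fin d) ℝ) (a : ℤ) (n : ℕ)
    (S : ℤ → Set (Fin M)) : Matrix (Fin d) (Fin d) ℝ :=
  seqProd (fun j => setSum N (S (a + j))) n

/-- The weight of a rectangle. -/
noncomputable def boxWeight (N : Fin M → Matrix (Fin d) (Fin d) ℝ) (u v : Fin d → ℝ) (a : ℤ)
    (n : ℕ) (S : ℤ → Set (Fin M)) : ℝ :=
  (boxProd N a n S *ᵥ u) ⬝ᵥ v

lemma box_univ (a : ℤ) (n : ℕ) : box a n (fun _ => (univ : Set (Fin M))) = univ := by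
  ext x; simp [box]

lemma boxProd_add (N : Fin M → Matrix (Fin d) (Fin d) ℝ) (a : ℤ) (m n : ℕ)
    (S : ℤ → Set (Fin M)) : boxProd N a (m + n) S = boxProd N a m S * boxProd N (a + m) n S := by
  rw [boxProd, seqProd_add]
  simp [boxProd, add_assoc]

lemma boxProd_congr {a : ℤ} {n : ℕ} {S T : ℤ → Set (Fin M)}
    (h : ∀ i, a ≤ i → i < a + n → S i = T i) : boxProd N a n S = boxProd N a n T :=
  seqProd_congr fun j hj => by rw [h (a + j) (by lia) (by lia)]

lemma boxProd_univ {a : ℤ} {n : ℕ} {S : ℤ → Set (Fin M)}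
    (h : ∀ i, a ≤ i → i < a + n → S i = univ) : boxProd N a n S = (∑ i, N i) ^ n := by
  rw [boxProd_congr (T := fun _ => univ) h, boxProd]
  simp only [setSum_univ, seqProd_const]

lemma boxProd_translate (a c : ℤ) (n : ℕ) (S : ℤ → Set (Fin M)) :
    boxProd N (a + c) n (fun i => S (i - c)) = boxProd N a n S :=
  seqProd_congr fun j _ => by
    simp only [show a + c + (j : ℤ) - c = a + j by ring]

/-- Extend the constraints trivially outside the window. -/
def padSets (a : ℤ) (n : ℕ) (S : ℤ → Set (Fin M)) (i : ℤ) : Set (Fin M) :=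
  {c | a ≤ i → i < a + n → c ∈ S i}

lemma padSets_of_mem {a : ℤ} {n : ℕ} {S : ℤ → Set (Fin M)} {i : ℤ} (h : a ≤ i) (h' : i < a + n) :
    padSets a n S i = S i := by
  ext c; simp [padSets, h, h']

lemma padSets_of_notMem {a : ℤ} {n : ℕ} {S : ℤ → Set (Fin M)} {i : ℤ} (h : ¬(a ≤ i ∧ i < a + n)) :
    padSets a n S i = univ := by
  ext c
  simp only [padSets, mem_ofPred_eq, mem_univ, iff_true]
  exact fun h1 h2 => absurd ⟨h1, h2⟩ h

lemma box_padSets {a a' : ℤ} {n n' : ℕ} (h : a' ≤ a) (h' : a + n ≤ a' + n')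
    (S : ℤ → Set (Fin M)) : box a' n' (padSets a n S) = box a n S := by
  ext x
  simp only [box, padSets, mem_ofPred_eq]
  exact ⟨fun hx i h1 h2 => hx i (by lia) (by lia) h1 h2, fun hx i _ _ h1 h2 => hx i h1 h2⟩

/-- Kolmogorov consistency: free places on the right and left contribute powers of the total matrix,
which are absorbed by u and v respectively. -/
lemma boxWeight_padSets (hN : PerronData K (∑ i, N i) 1 u v) {a a' : ℤ} {n n' : ℕ}
    (h : a' ≤ a) (h' : a + n ≤ a' + n') (S : ℤ → Set (Fin M)) :
    boxWeight N u v a' n' (padSets a n S) = boxWeight N u v a n S := by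
  obtain ⟨p, rfl⟩ : ∃ p : ℕ, a = a' + p := ⟨(a - a').toNat, by lia⟩
  obtain ⟨k, rfl⟩ : ∃ k : ℕ, n' = p + n + k := ⟨n' - (p + n), by lia⟩
  rw [boxWeight, boxProd_add, boxProd_add, boxProd_univ (n := p), boxProd_univ (n := k),
    ← mulVec_mulVec, (hN.pow k).right, one_pow, one_smul, ← mulVec_mulVec,
    (hN.pow p).dotProduct_mulVec, one_pow, one_mul,
    boxProd_congr (n := n) (fun i hi hi' => padSets_of_mem hi hi'), boxWeight]
  · exact fun i h1 h2 => padSets_of_notMem (by push_cast at *; lia)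
  · exact fun i h1 h2 => padSets_of_notMem (by push_cast at *; lia)

lemma isClopen_box (a : ℤ) (n : ℕ) (S : ℤ → Set (Fin M)) : IsClopen (box a n S) := by
  have : box a n S = ⋂ i ∈ Finset.Ico a (a + n), (fun x : ℤ → Fin M => x i) ⁻¹' S i := by
    ext x; simp [box]
  rw [this]
  exact isClopen_biInter_finset fun i _ => (isClopen_discrete (S i)).preimage (continuous_apply i)

lemma measurableSet_box (a : ℤ) (n : ℕ) (S : ℤ → Set (Fin M)) : MeasurableSet (box a n S) :=
  (isClopen_box a n S).isOpen.measurableSet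

/-- The rectangles. -/
def boxes (M : ℕ) : Set (Set (ℤ → Fin M)) := {s | ∃ a n S, s = box a n S}

/-- Padding brings both rectangles to a common window, where constraints intersect place by place.
-/
lemma isPiSystem_boxes : IsPiSystem (boxes M) := by
  rintro _ ⟨a, n, S, rfl⟩ _ ⟨b, m, T, rfl⟩ -
  obtain ⟨c, k, h1, h2, h3, h4⟩ : ∃ (c : ℤ) (k : ℕ), c ≤ a ∧ c ≤ b ∧ a + n ≤ c + k ∧
      b + m ≤ c + k :=
    ⟨min a b, (max (a + n) (b + m) - min a b).toNat, by lia, by lia, by lia, by lia⟩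
  refine ⟨c, k, fun i => padSets a n S i ∩ padSets b m T i, ?_⟩
  rw [← box_padSets h1 h3, ← box_padSets h2 h4]
  ext x
  simp only [box, mem_inter_iff, mem_ofPred_eq]
  exact ⟨fun h i h1 h2 => ⟨h.1 i h1 h2, h.2 i h1 h2⟩,
    fun h => ⟨fun i h1 h2 => (h i h1 h2).1, fun i h1 h2 => (h i h1 h2).2⟩⟩

lemma generateFrom_boxes : (inferInstance : MeasurableSpace (ℤ → Fin M)) =
    MeasurableSpace.generateFrom (boxes M) := by
  apply le_antisymm
  · refine (MeasurableSpace.pi_eq_generateFrom_projections).le.trans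
      (MeasurableSpace.generateFrom_mono ?_)
    rintro _ ⟨i, A, -, rfl⟩
    refine ⟨i, 1, fun _ => A, ?_⟩
    ext x
    simp only [box, mem_ofPred_eq, mem_preimage, Function.eval]
    refine ⟨fun h j h1 h2 => ?_, fun h => h i le_rfl (by simp)⟩
    obtain rfl : j = i := by push_cast at h2; lia
    exact h
  · apply MeasurableSpace.generateFrom_le
    rintro _ ⟨a, n, S, rfl⟩
    exact measurableSet_box a n S

lemma ext_of_boxes {μ ν : Measure (ℤ → Fin M)} [IsFiniteMeasure μ] [IsFiniteMeasure ν]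
    (h : ∀ a n S, μ.real (box a n S) = ν.real (box a n S)) : μ = ν := by
  refine ext_of_generate_finite (boxes M) generateFrom_boxes isPiSystem_boxes ?_ ?_
  · rintro _ ⟨a, n, S, rfl⟩
    exact (measureReal_eq_measureReal_iff (measure_ne_top _ _) (measure_ne_top _ _)).1 (h a n S)
  · rw [← box_univ 0 0]
    exact (measureReal_eq_measureReal_iff (measure_ne_top _ _) (measure_ne_top _ _)).1 (h _ _ _)

/-! ### Construction of the measure -/

/-- The sequence that reads `w` in the window `[-m, m)` and is constant elsewhere. -/
def extendWord (c : Fin M) (m : ℕ) (w : Fin (2 * m) → Fin M) (i : ℤ) : Fin M :=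
  if h : (i + m).toNat < 2 * m then w ⟨(i + m).toNat, h⟩ else c

lemma extendWord_mem_box (c : Fin M) (m : ℕ) (w : Fin (2 * m) → Fin M) (S : ℤ → Set (Fin M)) :
    extendWord c m w ∈ box (-m) (2 * m) S ↔ ∀ j : Fin (2 * m), w j ∈ S (-m + (j : ℕ)) := by
  simp only [box, mem_ofPred_eq, extendWord]
  constructor
  · intro h j
    have := h (-m + (j : ℕ)) (by lia) (by have := j.2; push_cast; lia)
    rwa [dif_pos (by have := j.2; simp only [neg_add_cancel_comm, Int.toNat_natCast]; exact this),
      show (⟨(-(m : ℤ) + (j : ℕ) + m).toNat, _⟩ : Fin (2 * m)) = j from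
        Fin.ext (by simp)] at this
  · intro h i h1 h2
    push_cast at h2
    have hlt : (i + m).toNat < 2 * m := by lia
    rw [dif_pos hlt]
    have := h ⟨(i + m).toNat, hlt⟩
    rwa [show (-(m : ℤ) + (((⟨(i + m).toNat, hlt⟩ : Fin (2 * m)) : ℕ) : ℤ)) = i by
      simp only; lia] at this

/-- A finitely supported measure with the right weights in the window `[-m, m)`. -/
noncomputable def windowMeasure (N : Fin M → Matrix (Fin d) (Fin d) ℝ) (u v : Fin d → ℝ)
    (c : Fin M) (m : ℕ) : Measure (ℤ → Fin M) :=
  ∑ w : Fin (2 * m) → Fin M,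
    ENNReal.ofReal ((wordProd N w *ᵥ u) ⬝ᵥ v) • Measure.dirac (extendWord c m w)

lemma KNonneg.wordProd (h : ∀ i, KNonneg K (N i)) {n : ℕ} (w : Fin n → Fin M) :
    KNonneg K (wordProd N w) := by
  induction n with
  | zero => intro x hx; simpa [MatrixGibbs.wordProd] using hx
  | succ n ih =>
    intro x hx
    rw [MatrixGibbs.wordProd, List.ofFn_succ, List.prod_cons, ← mulVec_mulVec]
    exact h _ _ (ih (fun j => w j.succ) x hx)

lemma wordWeight_nonneg {B : Matrix (Fin d) (Fin d) ℝ} {r : ℝ} (h : PerronData K B r u v)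
    (hN : ∀ i, KNonneg K (N i)) {n : ℕ} (w : Fin n → Fin M) : 0 ≤ (wordProd N w *ᵥ u) ⬝ᵥ v :=
  h.pos.nonneg (KNonneg.wordProd hN w u (interior_subset h.mem_interior))

/-- Expand the product of sums over words; a word with a forbidden letter has a zero factor. -/
lemma sum_wordWeight (N : Fin M → Matrix (Fin d) (Fin d) ℝ) (u v : Fin d → ℝ) (a : ℤ) (n : ℕ)
    (S : ℤ → Set (Fin M)) [∀ w : Fin n → Fin M, Decidable (∀ j : Fin n, w j ∈ S (a + (j : ℕ)))] :
    ∑ w : Fin n → Fin M,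
      (if ∀ j : Fin n, w j ∈ S (a + (j : ℕ)) then (wordProd N w *ᵥ u) ⬝ᵥ v else 0) =
      boxWeight N u v a n S := by
  have h1 := sum_prod_ofFn (n := n) fun j i => (S (a + (j : ℕ))).indicator N i
  have h2 : boxProd N a n S = (List.ofFn fun j : Fin n =>
      ∑ i, (S (a + (j : ℕ))).indicator N i).prod := rfl
  rw [boxWeight, h2, ← h1, sum_mulVec, sum_dotProduct]
  refine Finset.sum_congr rfl fun w _ => ?_
  split_ifs with hw
  · simp only [wordProd]
    congr 5
    ext1 j
    rw [indicator_of_mem (hw j)]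
  · push Not at hw
    obtain ⟨j, hj⟩ := hw
    rw [List.prod_eq_zero, zero_mulVec, zero_dotProduct]
    rw [List.mem_ofFn]
    exact ⟨j, indicator_of_notMem hj _⟩

lemma windowMeasure_box (hN : PerronData K (∑ i, N i) 1 u v) (hnn : ∀ i, KNonneg K (N i))
    (c : Fin M) {m : ℕ} {a : ℤ} {n : ℕ} (h : -m ≤ a) (h' : a + n ≤ m) (S : ℤ → Set (Fin M)) :
    windowMeasure N u v c m (box a n S) = ENNReal.ofReal (boxWeight N u v a n S) := by
  classical
  have h'' : a + n ≤ -(m : ℤ) + (2 * m : ℕ) := by push_cast; lia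
  rw [← box_padSets h h'' S, ← boxWeight_padSets hN h h'' S]
  set T := padSets a n S
  rw [← sum_wordWeight, ENNReal.ofReal_sum_of_nonneg, windowMeasure, Measure.finsetSum_apply]
  · refine Finset.sum_congr rfl fun w _ => ?_
    rw [Measure.smul_apply, Measure.dirac_apply' _ (measurableSet_box _ _ _), indicator_apply]
    simp only [extendWord_mem_box]
    split_ifs <;> simp
  · intro w _
    split_ifs
    · exact wordWeight_nonneg hN hnn w
    · exact le_rfl

/-- The measure with prescribed weights of rectangles. -/
theorem exists_measure_box (hN : PerronData K (∑ i, N i) 1 u v) (hnn : ∀ i, KNonneg K (N i))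
    (c : Fin M) : ∃ μ : Measure (ℤ → Fin M), IsProbabilityMeasure μ ∧
      ∀ a n S, μ.real (box a n S) = boxWeight N u v a n S := by
  have hprob : ∀ m, IsProbabilityMeasure (windowMeasure N u v c m) := fun m => ⟨by
    rw [← box_univ 0 0, windowMeasure_box hN hnn c (by simp) (by simp), boxWeight,
      boxProd_univ (fun _ _ _ => rfl), pow_zero, one_mulVec, hN.inner, ENNReal.ofReal_one]⟩
  set ms : ℕ → ProbabilityMeasure (ℤ → Fin M) := fun m => ⟨windowMeasure N u v c m, hprob m⟩
  -- Compactness of the space of probability measures supplies a limit along an ultrafilter.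
  -- Rectangles are clopen, so their measures pass to the limit, and each rectangle fits into all
  -- windows from some m on.
  set F : Ultrafilter (ProbabilityMeasure (ℤ → Fin M)) := (hyperfilter ℕ).map ms
  have hF : Tendsto ms (hyperfilter ℕ) (𝓝 F.lim) := F.le_nhds_lim
  refine ⟨F.lim, inferInstance, fun a n S => ?_⟩
  have hlim := ProbabilityMeasure.tendsto_measure_of_null_frontier_of_tendsto' hF
    (E := box a n S) (by rw [(isClopen_box a n S).frontier_eq, measure_empty])
  have hev : ∀ᶠ m in (hyperfilter ℕ : Filter ℕ),
      ENNReal.ofReal (boxWeight N u v a n S) = (ms m : Measure (ℤ → Fin M)) (box a n S) := by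
    refine Nat.hyperfilter_le_atTop ?_
    filter_upwards [eventually_ge_atTop (a.natAbs + n)] with m hm
    exact (windowMeasure_box hN hnn c (by lia) (by lia) S).symm
  have heq := tendsto_nhds_unique hlim (tendsto_const_nhds.congr' hev)
  have h0 : 0 ≤ boxWeight N u v a n S := by
    classical
    rw [← sum_wordWeight]
    refine Finset.sum_nonneg fun w _ => ?_
    split_ifs
    · exact wordWeight_nonneg hN hnn w
    · exact le_rfl
  rw [measureReal_def, heq, ENNReal.toReal_ofReal h0]

end MatrixGibbs

namespace MatrixGibbs

open Set Filter Topology Matrix MeasureTheory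

variable {d M : ℕ} {K : Set (Fin d → ℝ)} {N : Fin M → Matrix (Fin d) (Fin d) ℝ}
  {u v : Fin d → ℝ} {μ : Measure (ℤ → Fin M)}

/-! ### Cylinders and their correlations -/

/-- The cylinder of the word `w` at the place `a`. -/
def cylinderAt (a : ℤ) {n : ℕ} (w : Fin n → Fin M) : Set (ℤ → Fin M) :=
  {x | ∀ j : Fin n, x (a + (j : ℕ)) = w j}

lemma wordCylinder_eq_cylinderAt {n : ℕ} (w : Fin n → Fin M) :
    wordCylinder w = cylinderAt 0 w := by
  ext x
  simp [wordCylinder, cylinderAt]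

/-- The constraints that define a cylinder. -/
def wordSets (a : ℤ) {n : ℕ} (w : Fin n → Fin M) (i : ℤ) : Set (Fin M) :=
  {c | ∀ j : Fin n, a + (j : ℕ) = i → c = w j}

lemma cylinderAt_eq_box (a : ℤ) {n : ℕ} (w : Fin n → Fin M) :
    cylinderAt a w = box a n (wordSets a w) := by
  ext x
  simp only [cylinderAt, box, wordSets, mem_ofPred_eq]
  constructor
  · rintro h i - - j rfl
    exact h j
  · intro h j
    exact h _ (by lia) (by have := j.2; lia) j rfl

lemma boxProd_wordSets (a : ℤ) {n : ℕ} (w : Fin n → Fin M) :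
    boxProd N a n (wordSets a w) = wordProd N w := by
  simp only [boxProd, seqProd, wordProd]
  congr 2
  ext1 j
  have : wordSets a w (a + (j : ℕ)) = {w j} := by
    ext c
    simp only [wordSets, mem_ofPred_eq, mem_singleton_iff]
    refine ⟨fun h => h j rfl, fun h k hk => ?_⟩
    rw [h, show k = j from Fin.ext (by lia)]
  rw [this, setSum_singleton]

lemma isClopen_cylinderAt (a : ℤ) {n : ℕ} (w : Fin n → Fin M) : IsClopen (cylinderAt a w) := by
  rw [cylinderAt_eq_box]; exact isClopen_box _ _ _

lemma measurableSet_cylinderAt (a : ℤ) {n : ℕ} (w : Fin n → Fin M) :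
    MeasurableSet (cylinderAt a w) := (isClopen_cylinderAt a w).isOpen.measurableSet

lemma iUnion_cylinderAt (M : ℕ) (a : ℤ) (n : ℕ) :
    ⋃ w : Fin n → Fin M, cylinderAt a w = univ := by
  refine eq_univ_of_forall fun x => mem_iUnion.2 ⟨fun j => x (a + (j : ℕ)), fun j => rfl⟩

lemma pairwise_disjoint_cylinderAt (M : ℕ) (a : ℤ) (n : ℕ) :
    Pairwise (Function.onFun Disjoint fun w : Fin n → Fin M => cylinderAt a w) := by
  intro w w' hne
  refine disjoint_left.2 fun x hx hx' => hne (funext fun j => ?_)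
  rw [← hx j, hx' j]

lemma sum_measureReal_cylinderAt [IsProbabilityMeasure μ] (a : ℤ) (n : ℕ) :
    ∑ w : Fin n → Fin M, μ.real (cylinderAt a w) = 1 := by
  rw [← measureReal_iUnion_fintype (pairwise_disjoint_cylinderAt M a n)
    (fun w => measurableSet_cylinderAt a w), iUnion_cylinderAt, probReal_univ]

lemma box_inter_box (a : ℤ) (p g q : ℕ) (S T : ℤ → Set (Fin M)) :
    box a p S ∩ box (a + p + g) q T =
      box a (p + g + q) fun i => padSets a p S i ∩ padSets (a + p + g) q T i := by
  rw [← box_padSets (a := a) (a' := a) (n' := p + g + q) le_rfl (by push_cast; lia) S,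
    ← box_padSets (a := a + p + g) (a' := a) (n' := p + g + q) (by lia) (by push_cast; lia) T]
  ext x
  simp only [box, mem_inter_iff, mem_ofPred_eq]
  exact ⟨fun h i h1 h2 => ⟨h.1 i h1 h2, h.2 i h1 h2⟩,
    fun h => ⟨fun i h1 h2 => (h i h1 h2).1, fun i h1 h2 => (h i h1 h2).2⟩⟩

/-- The g free places between the windows contribute the g-th power of the total matrix. All mixing
statements start here. -/
lemma boxProd_inter (a : ℤ) (p g q : ℕ) (S T : ℤ → Set (Fin M)) :
    boxProd N a (p + g + q) (fun i => padSets a p S i ∩ padSets (a + p + g) q T i) =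
      boxProd N a p S * (∑ i, N i) ^ g * boxProd N (a + p + g) q T := by
  rw [boxProd_add, boxProd_add]
  congr 1
  · congr 1
    · refine boxProd_congr fun i h1 h2 => ?_
      rw [padSets_of_mem h1 h2, padSets_of_notMem (by lia), inter_univ]
    · refine boxProd_univ fun i h1 h2 => ?_
      rw [padSets_of_notMem (by lia), padSets_of_notMem (by lia), inter_univ]
  · rw [Nat.cast_add, ← add_assoc]
    refine boxProd_congr fun i h1 h2 => ?_
    rw [padSets_of_mem h1 h2, padSets_of_notMem (by lia), univ_inter]

/-- `μ` gives every rectangle its weight. -/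
def HasBoxWeights (N : Fin M → Matrix (Fin d) (Fin d) ℝ) (u v : Fin d → ℝ)
    (μ : Measure (ℤ → Fin M)) : Prop :=
  ∀ a n S, μ.real (box a n S) = boxWeight N u v a n S

namespace HasBoxWeights

lemma cylinderAt (hμ : HasBoxWeights N u v μ) (a : ℤ) {n : ℕ} (w : Fin n → Fin M) :
    μ.real (cylinderAt a w) = (wordProd N w *ᵥ u) ⬝ᵥ v := by
  rw [cylinderAt_eq_box, hμ, boxWeight, boxProd_wordSets]

lemma inter (hμ : HasBoxWeights N u v μ) (a : ℤ) (p g q : ℕ) (S T : ℤ → Set (Fin M)) :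
    μ.real (box a p S ∩ box (a + p + g) q T) =
      (boxProd N a p S *ᵥ ((∑ i, N i) ^ g *ᵥ (boxProd N (a + p + g) q T *ᵥ u))) ⬝ᵥ v := by
  rw [box_inter_box, hμ, boxWeight, boxProd_inter, ← mulVec_mulVec, ← mulVec_mulVec]

lemma inter_cylinderAt (hμ : HasBoxWeights N u v μ) (a : ℤ) (g : ℕ) {p q : ℕ}
    (w : Fin p → Fin M) (z : Fin q → Fin M) :
    μ.real (MatrixGibbs.cylinderAt a w ∩ MatrixGibbs.cylinderAt (a + p + g) z) =
      (wordProd N w *ᵥ ((∑ i, N i) ^ g *ᵥ (wordProd N z *ᵥ u))) ⬝ᵥ v := by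
  rw [cylinderAt_eq_box, cylinderAt_eq_box, hμ.inter, boxProd_wordSets, boxProd_wordSets]

end HasBoxWeights

lemma measurable_shift : Measurable (shift : (ℤ → Fin M) → ℤ → Fin M) :=
  measurable_pi_lambda _ fun i => measurable_pi_apply (i + 1)

lemma shift_iterate_apply (n : ℕ) (x : ℤ → Fin M) (i : ℤ) : shift^[n] x i = x (i + n) := by
  induction n generalizing i with
  | zero => simp
  | succ n ih =>
    rw [Function.iterate_succ', Function.comp_apply, shift, ih]
    congr 1
    push_cast
    ring

lemma preimage_shift_box (k : ℕ) (a : ℤ) (n : ℕ) (S : ℤ → Set (Fin M)) :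
    shift^[k] ⁻¹' box a n S = box (a + k) n fun i => S (i - k) := by
  ext x
  simp only [box, mem_preimage, mem_ofPred_eq, shift_iterate_apply]
  constructor
  · intro h i h1 h2
    have := h (i - k) (by lia) (by lia)
    rwa [sub_add_cancel] at this
  · intro h i h1 h2
    have := h (i + k) (by lia) (by lia)
    rwa [add_sub_cancel_right] at this

lemma preimage_shift_cylinderAt (k : ℕ) (a : ℤ) {n : ℕ} (w : Fin n → Fin M) :
    shift^[k] ⁻¹' cylinderAt a w = cylinderAt (a + k) w := by
  ext x
  simp only [cylinderAt, mem_preimage, mem_ofPred_eq, shift_iterate_apply, add_right_comm]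

namespace HasBoxWeights

/-- The weight of a rectangle is unchanged by translation, and rectangles determine a finite
measure. -/
lemma measurePreserving (hμ : HasBoxWeights N u v μ) [IsProbabilityMeasure μ] :
    MeasurePreserving shift μ μ := by
  refine ⟨measurable_shift, ?_⟩
  have := Measure.isProbabilityMeasure_map (μ := μ) (measurable_shift (M := M)).aemeasurable
  refine ext_of_boxes fun a n S => ?_
  rw [map_measureReal_apply measurable_shift (measurableSet_box _ _ _)]
  have h1 := preimage_shift_box 1 a n S
  rw [Function.iterate_one] at h1
  rw [h1, hμ, hμ, boxWeight, boxProd_translate, boxWeight]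

end HasBoxWeights

/-! ### Ergodicity -/

/-- A shift of the argument does not influence the limit of Cesàro averages. -/
lemma tendsto_average_of_shift {f : ℕ → ℝ} (hf : ∀ k, |f k| ≤ 1) {L : ℝ} (k₀ : ℕ)
    (h : Tendsto (fun n : ℕ => (n : ℝ)⁻¹ * ∑ k ∈ Finset.range n, f (k₀ + k)) atTop (𝓝 L)) :
    Tendsto (fun n : ℕ => (n : ℝ)⁻¹ * ∑ k ∈ Finset.range n, f k) atTop (𝓝 L) := by
  induction k₀ with
  | zero => simpa using h
  | succ m ih =>
    apply ih
    have hsmall : Tendsto (fun n : ℕ => (n : ℝ)⁻¹ * (f m - f (m + n))) atTop (𝓝 0) := by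
      refine squeeze_zero_norm (a := fun n : ℕ => (n : ℝ)⁻¹ * 2) (fun n => ?_) ?_
      · rw [norm_mul, norm_inv, Real.norm_natCast, Real.norm_eq_abs]
        gcongr
        linarith [abs_sub (f m) (f (m + n)), hf m, hf (m + n)]
      · simpa using (tendsto_inv_atTop_nhds_zero_nat (𝕜 := ℝ)).mul_const 2
    have h2 := h.add hsmall
    rw [add_zero] at h2
    refine h2.congr fun n => ?_
    rw [← mul_add]
    congr 1
    have e1 := Finset.sum_range_succ (fun k => f (m + k)) n
    have e2 := Finset.sum_range_succ' (fun k => f (m + k)) n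
    have e3 : ∑ k ∈ Finset.range n, f (m + 1 + k) = ∑ k ∈ Finset.range n, f (m + (k + 1)) :=
      Finset.sum_congr rfl fun k _ => by rw [add_assoc, add_comm 1]
    simp only [add_zero] at e2
    linarith

/-- The correlations of `C` and `D` converge in the mean to the product of the measures. -/
def MeanMixing (μ : Measure (ℤ → Fin M)) (C D : Set (ℤ → Fin M)) : Prop :=
  Tendsto (fun n : ℕ => (n : ℝ)⁻¹ * ∑ k ∈ Finset.range n, μ.real (C ∩ shift^[k] ⁻¹' D)) atTop
    (𝓝 (μ.real C * μ.real D))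

/-- Once the second window is to the right of the first, the correlation is a fixed linear
functional of N^g applied to a fixed vector, so Cesàro convergence of the powers suffices. -/
lemma HasBoxWeights.meanMixing (hμ : HasBoxWeights N u v μ) [IsProbabilityMeasure μ]
    (hces : ∀ x, Tendsto (fun n : ℕ => (n : ℝ)⁻¹ • ∑ k ∈ Finset.range n, ((∑ i, N i) ^ k) *ᵥ x)
      atTop (𝓝 ((x ⬝ᵥ v) • u)))
    (a : ℤ) (p : ℕ) (S : ℤ → Set (Fin M)) (b : ℤ) (q : ℕ) (T : ℤ → Set (Fin M)) :
    MeanMixing μ (box a p S) (box b q T) := by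
  -- Lengthen the first window until it ends at or beyond b. A shift by k₀ + g then puts the second
  -- window exactly g places after it.
  obtain ⟨p', hp, hb⟩ : ∃ p' : ℕ, p ≤ p' ∧ b ≤ a + p' :=
    ⟨p + (b - a).toNat, by lia, by lia⟩
  rw [← box_padSets (a' := a) (n' := p') le_rfl (by lia) S]
  set S' := padSets a p S
  obtain ⟨k₀, hk₀⟩ : ∃ k₀ : ℕ, a + p' = b + k₀ := ⟨(a + p' - b).toNat, by lia⟩
  refine tendsto_average_of_shift (fun k => ?_) k₀ ?_
  · rw [abs_of_nonneg measureReal_nonneg]; exact measureReal_le_one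
  have hterm : ∀ g : ℕ, μ.real (box a p' S' ∩ shift^[k₀ + g] ⁻¹' box b q T) =
      (boxProd N a p' S' *ᵥ ((∑ i, N i) ^ g *ᵥ (boxProd N b q T *ᵥ u))) ⬝ᵥ v := by
    intro g
    have h1 := boxProd_translate (N := N) b ((k₀ + g : ℕ) : ℤ) q T
    rw [preimage_shift_box]
    rw [show b + ((k₀ + g : ℕ) : ℤ) = a + p' + g by push_cast; lia] at *
    rw [hμ.inter, h1]
  simp only [hterm]
  have hcont : Continuous fun x : Fin d → ℝ => (boxProd N a p' S' *ᵥ x) ⬝ᵥ v :=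
    (continuous_dotProduct_left v).comp (Continuous.matrix_mulVec continuous_const continuous_id)
  have hlim := (hcont.tendsto _).comp (hces (boxProd N b q T *ᵥ u))
  rw [hμ, hμ]
  simp only [mulVec_smul, smul_dotProduct, smul_eq_mul] at hlim
  rw [mul_comm] at hlim
  refine hlim.congr fun n => ?_
  simp only [Function.comp_apply, mulVec_smul, smul_dotProduct, smul_eq_mul, mulVec_sum,
    sum_dotProduct]

/-- A π-λ induction over D with C fixed. For disjoint unions, limit and sum are exchanged by
dominated convergence; invariance provides the majorant μ(f i). -/
lemma MeanMixing.of_boxes [IsProbabilityMeasure μ] (hμ : MeasurePreserving shift μ μ)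
    {C : Set (ℤ → Fin M)} (hC : MeasurableSet C)
    (h : ∀ a n S, MeanMixing μ C (box a n S)) {D : Set (ℤ → Fin M)} (hD : MeasurableSet D) :
    MeanMixing μ C D := by
  have hit : ∀ k, MeasurePreserving (shift^[k]) μ μ := fun k => hμ.iterate k
  induction D, hD using MeasurableSpace.induction_on_inter generateFrom_boxes isPiSystem_boxes with
  | empty => simp [MeanMixing]
  | basic D hD => obtain ⟨a, n, S, rfl⟩ := hD; exact h a n S
  | compl D hD ih =>
    have h1 : ∀ k, μ.real (C ∩ shift^[k] ⁻¹' Dᶜ) =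
        μ.real C - μ.real (C ∩ shift^[k] ⁻¹' D) := fun k => by
      have := measureReal_inter_add_sdiff (μ := μ) (s := C) ((hit k).measurable hD)
      rw [preimage_compl, ← sdiff_eq]
      linarith
    have h2 := (tendsto_const_nhds (x := μ.real C)).sub ih
    rw [MeanMixing, probReal_compl_eq_one_sub hD, mul_sub, mul_one]
    refine h2.congr' ?_
    filter_upwards [eventually_gt_atTop 0] with n hn
    have : (n : ℝ) ≠ 0 := by positivity
    simp only [h1, Finset.sum_sub_distrib, Finset.sum_const, Finset.card_range, nsmul_eq_mul,
      mul_sub]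
    field_simp
  | iUnion f hdisj hf ih =>
    have hsum : ∀ (s : Set (ℤ → Fin M)) (hs : MeasurableSet s) (k : ℕ),
        HasSum (fun i => μ.real (s ∩ shift^[k] ⁻¹' f i)) (μ.real (s ∩ shift^[k] ⁻¹' ⋃ i, f i)) := by
      intro s hs k
      rw [preimage_iUnion, inter_iUnion]
      have hm : ∀ i, MeasurableSet (s ∩ shift^[k] ⁻¹' f i) := fun i =>
        hs.inter ((hit k).measurable (hf i))
      have hd : Pairwise (Function.onFun Disjoint fun i => s ∩ shift^[k] ⁻¹' f i) :=
        fun i j hij => ((hdisj hij).preimage _).mono inter_subset_right inter_subset_right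
      have := measure_iUnion (μ := μ) hd hm
      rw [measureReal_def, this, ENNReal.tsum_toReal_eq fun i => measure_ne_top _ _]
      refine (ENNReal.summable_toReal ?_).hasSum
      rw [← this]
      exact measure_ne_top _ _
    have h0 : HasSum (fun i => μ.real (f i)) (μ.real (⋃ i, f i)) := by
      simpa using hsum univ MeasurableSet.univ 0
    have hle : ∀ k i, μ.real (C ∩ shift^[k] ⁻¹' f i) ≤ μ.real (f i) := fun k i => by
      refine (measureReal_mono inter_subset_right).trans_eq ?_
      exact (hit k).measureReal_preimage (hf i).nullMeasurableSet
    have key := tendsto_tsum_of_dominated_convergence (𝓕 := atTop)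
      (f := fun (n : ℕ) i => (n : ℝ)⁻¹ * ∑ k ∈ Finset.range n, μ.real (C ∩ shift^[k] ⁻¹' f i))
      (g := fun i => μ.real C * μ.real (f i)) h0.summable ih (Eventually.of_forall fun n i => by
        rw [Real.norm_of_nonneg (mul_nonneg (by positivity)
          (Finset.sum_nonneg fun k _ => measureReal_nonneg))]
        rcases Nat.eq_zero_or_pos n with rfl | hn
        · simp
        · rw [inv_mul_le_iff₀ (by positivity)]
          refine (Finset.sum_le_sum fun k _ => hle k i).trans ?_
          simp)
    rw [tsum_mul_left, h0.tsum_eq] at key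
    refine key.congr fun n => ?_
    rw [tsum_mul_left, ((hasSum_sum fun k _ => hsum C hC k).tsum_eq)]

/-- For invariant E the correlations with a rectangle are constant in k, so E is independent of
every rectangle. Hence μ restricted to E equals μ(E)μ, and evaluation at E gives μ(E) = μ(E)². -/
lemma HasBoxWeights.ergodic (hμ : HasBoxWeights N u v μ) [IsProbabilityMeasure μ]
    (hces : ∀ x, Tendsto (fun n : ℕ => (n : ℝ)⁻¹ • ∑ k ∈ Finset.range n, ((∑ i, N i) ^ k) *ᵥ x)
      atTop (𝓝 ((x ⬝ᵥ v) • u))) : Ergodic shift μ := by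
  refine ⟨hμ.measurePreserving, ⟨fun E hE hinv => ?_⟩⟩
  have hk : ∀ k, shift^[k] ⁻¹' E = E := fun k => by
    rw [preimage_iterate_eq]
    exact Function.iterate_fixed hinv k
  have hbox : ∀ a n S, μ.real (box a n S ∩ E) = μ.real (box a n S) * μ.real E := by
    intro a n S
    have h1 := MeanMixing.of_boxes hμ.measurePreserving (measurableSet_box a n S)
      (hμ.meanMixing hces a n S) hE
    refine tendsto_nhds_unique (tendsto_const_nhds.congr' ?_) h1
    filter_upwards [eventually_gt_atTop 0] with m hm
    have : (m : ℝ) ≠ 0 := by positivity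
    simp only [hk, Finset.sum_const, Finset.card_range, nsmul_eq_mul]
    field_simp
  have : IsFiniteMeasure (μ E • μ) := ⟨by
    simp⟩
  have heq : μ.restrict E = μ E • μ := by
    refine ext_of_boxes fun a n S => ?_
    rw [measureReal_restrict_apply (measurableSet_box a n S), hbox, measureReal_ennreal_smul_apply,
      mul_comm, measureReal_def]
  have h2 : μ E = μ E * μ E := by
    have := congrArg (fun m : Measure (ℤ → Fin M) => m E) heq
    simpa [Measure.restrict_apply hE] using this
  rw [eventuallyConst_set']
  by_cases h0 : μ E = 0
  · left; exact ae_eq_empty.2 h0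
  · right
    have h3 : μ E = 1 := by
      have := (ENNReal.mul_eq_left h0 (measure_ne_top μ E)).1 h2.symm
      exact this
    rw [ae_eq_univ, prob_compl_eq_zero_iff hE]
    exact h3

end MatrixGibbs

namespace MatrixGibbs

open Set Filter Topology Matrix MeasureTheory

variable {d M : ℕ} {K : Set (Fin d → ℝ)} {N : Fin M → Matrix (Fin d) (Fin d) ℝ}
  {u v : Fin d → ℝ} {μ ν : Measure (ℤ → Fin M)}

/-! ### The Gibbs property -/

/-- The Euclidean operator norm is equivalent to the operator norm for the maximum norm. -/
lemma exists_opNorm_equiv (d : ℕ) : ∃ C : ℝ, 0 < C ∧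
    (∀ (T : Matrix (Fin d) (Fin d) ℝ) (x : Fin d → ℝ), ‖T *ᵥ x‖ ≤ C * opNorm T * ‖x‖) ∧
    ∀ (T : Matrix (Fin d) (Fin d) ℝ) (b : ℝ), 0 ≤ b → (∀ x : Fin d → ℝ, ‖T *ᵥ x‖ ≤ b * ‖x‖) →
      opNorm T ≤ C * b := by
  set E := PiLp.continuousLinearEquiv 2 ℝ (fun _ : Fin d => ℝ) with hE
  set a := ‖(E : PiLp 2 (fun _ : Fin d => ℝ) →L[ℝ] (Fin d → ℝ))‖
  set b := ‖(E.symm : (Fin d → ℝ) →L[ℝ] PiLp 2 (fun _ : Fin d => ℝ))‖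
  have ha : ∀ x : Fin d → ℝ, ‖x‖ ≤ a * ‖WithLp.toLp 2 x‖ := fun x =>
    (E : PiLp 2 (fun _ : Fin d => ℝ) →L[ℝ] (Fin d → ℝ)).le_opNorm (WithLp.toLp 2 x)
  have hb : ∀ x : Fin d → ℝ, ‖WithLp.toLp 2 x‖ ≤ b * ‖x‖ := fun x =>
    (E.symm : (Fin d → ℝ) →L[ℝ] PiLp 2 (fun _ : Fin d => ℝ)).le_opNorm x
  have ha0 : 0 ≤ a := norm_nonneg _
  have hb0 : 0 ≤ b := norm_nonneg _
  refine ⟨a * b + 1, by positivity, fun T x => ?_, fun T c hc h => ?_⟩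
  · have hT0 : 0 ≤ opNorm T := norm_nonneg _
    calc ‖T *ᵥ x‖ ≤ a * ‖WithLp.toLp 2 (T *ᵥ x)‖ := ha _
      _ ≤ a * (opNorm T * ‖WithLp.toLp 2 x‖) := by
          gcongr
          rw [← toEuclideanCLM_toLp]
          exact ContinuousLinearMap.le_opNorm _ _
      _ ≤ a * (opNorm T * (b * ‖x‖)) := by gcongr; exact hb x
      _ = a * b * (opNorm T * ‖x‖) := by ring
      _ ≤ (a * b + 1) * (opNorm T * ‖x‖) := by gcongr; linarith
      _ = (a * b + 1) * opNorm T * ‖x‖ := by ring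
  · refine ContinuousLinearMap.opNorm_le_bound _ (by positivity) fun y => ?_
    obtain ⟨x, rfl⟩ : ∃ x : Fin d → ℝ, y = WithLp.toLp 2 x := ⟨y.ofLp, rfl⟩
    rw [toEuclideanCLM_toLp]
    calc ‖WithLp.toLp 2 (T *ᵥ x)‖ ≤ b * (c * (a * ‖WithLp.toLp 2 x‖)) :=
          (hb _).trans (by gcongr; exact (h x).trans (by gcongr; exact ha x))
      _ = a * b * (c * ‖WithLp.toLp 2 x‖) := by ring
      _ ≤ (a * b + 1) * (c * ‖WithLp.toLp 2 x‖) := by gcongr; linarith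
      _ = (a * b + 1) * c * ‖WithLp.toLp 2 x‖ := by ring

/-- On cone-preserving matrices the norm is comparable to a single matrix coefficient. -/
lemma exists_opNorm_comparison (hK : IsCone K) (hcl : IsClosed K) (hu : u ∈ interior K)
    (hv : StrictlyPositiveOn K v) :
    ∃ C : ℝ, 0 < C ∧ ∀ T, KNonneg K T →
      C⁻¹ * ((T *ᵥ u) ⬝ᵥ v) ≤ opNorm T ∧ opNorm T ≤ C * ((T *ᵥ u) ⬝ᵥ v) := by
  obtain ⟨C₁, hC₁, h₁, h₂⟩ := exists_opNorm_equiv d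
  obtain ⟨C₂, hC₂, h₃⟩ := exists_norm_mulVec_le_coeff hK hcl hu hv
  set b := d * (C₁ * ‖u‖) * ‖v‖ with hb
  have hb0 : 0 ≤ b := by positivity
  refine ⟨C₁ * C₂ + b + 1, by positivity, fun T hT => ⟨?_, ?_⟩⟩
  · have hT0 : 0 ≤ opNorm T := norm_nonneg _
    rw [inv_mul_le_iff₀ (by positivity)]
    calc (T *ᵥ u) ⬝ᵥ v ≤ d * ‖T *ᵥ u‖ * ‖v‖ := (le_abs_self _).trans (abs_dotProduct_le _ _)
      _ ≤ d * (C₁ * opNorm T * ‖u‖) * ‖v‖ := by gcongr; exact h₁ T u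
      _ = b * opNorm T := by rw [hb]; ring
      _ ≤ (C₁ * C₂ + b + 1) * opNorm T := by
          gcongr
          nlinarith
  · have hq : 0 ≤ (T *ᵥ u) ⬝ᵥ v := hv.nonneg (hT u (interior_subset hu))
    refine (h₂ T _ (by positivity) (h₃ T hT)).trans ?_
    rw [← mul_assoc]
    gcongr
    linarith

lemma wordProd_smul (c : ℝ) (A : Fin M → Matrix (Fin d) (Fin d) ℝ) {n : ℕ} (w : Fin n → Fin M) :
    wordProd (fun i => c • A i) w = c ^ n • wordProd A w := by
  induction n with
  | zero => simp [wordProd]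
  | succ n ih =>
    have h : ∀ A' : Fin M → Matrix (Fin d) (Fin d) ℝ,
        wordProd A' w = A' (w 0) * wordProd A' fun j => w j.succ := fun A' => by
      rw [wordProd, List.ofFn_succ, List.prod_cons]; rfl
    rw [h, h, ih, smul_mul_smul_comm, ← pow_succ']

/-- The pressure of a Gibbs state is determined by the matrices. -/
lemma IsGibbsStateWith.constant_le {A : Fin M → Matrix (Fin d) (Fin d) ℝ} {t P Q : ℝ}
    (hν : IsGibbsStateWith A t P ν) (hμ : IsGibbsStateWith A t Q μ) : Q ≤ P := by
  obtain ⟨hν1, -, C, hC, h⟩ := hν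
  obtain ⟨hμ1, -, D, hD, h'⟩ := hμ
  have key : ∀ n : ℕ, 0 < n → Real.exp (Q - P) ^ n ≤ C * D := by
    intro n hn
    -- Cylinders of length n have total mass one, so s is at most C e^{nP} by one state and at least
    -- D⁻¹ e^{nQ} by the other.
    set s := ∑ w : Fin n → Fin M, opNorm (wordProd A w) ^ t with hs
    have h1 : Real.exp (-(n * P)) * s ≤ C := by
      rw [hs, Finset.mul_sum]
      refine (Finset.sum_le_sum fun w _ => (h n hn w).2).trans ?_
      rw [← Finset.mul_sum]
      simp only [wordCylinder_eq_cylinderAt]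
      rw [sum_measureReal_cylinderAt, mul_one]
    have h2 : D⁻¹ ≤ Real.exp (-(n * Q)) * s := by
      rw [hs, Finset.mul_sum]
      refine le_trans ?_ (Finset.sum_le_sum fun w _ => (h' n hn w).1)
      rw [← Finset.mul_sum]
      simp only [wordCylinder_eq_cylinderAt]
      rw [sum_measureReal_cylinderAt, mul_one]
    have h3 : Real.exp (-(n * P)) = Real.exp (Q - P) ^ n * Real.exp (-(n * Q)) := by
      rw [← Real.exp_nat_mul, ← Real.exp_add]; congr 1; ring
    rw [h3, mul_assoc] at h1
    have h4 : Real.exp (Q - P) ^ n * D⁻¹ ≤ C :=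
      (mul_le_mul_of_nonneg_left h2 (by positivity)).trans h1
    rwa [← div_eq_mul_inv, div_le_iff₀ hD] at h4
  have h1 : Real.exp (Q - P) ≤ 1 := by
    refine le_of_forall_pow_le (C := C * D / Real.exp (Q - P)) zero_le_one fun n => ?_
    rw [one_pow, mul_one, le_div_iff₀ (Real.exp_pos _), ← pow_succ]
    exact key _ n.succ_pos
  have := Real.exp_le_one_iff.1 h1
  linarith

/-- The points that are forced into `U` by the coordinates in `[-m, m]`. -/
def cylinderInterior (U : Set (ℤ → Fin M)) (m : ℕ) : Set (ℤ → Fin M) :=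
  {x | ∀ y : ℤ → Fin M, (∀ i : ℤ, -m ≤ i → i ≤ m → y i = x i) → y ∈ U}

lemma monotone_cylinderInterior (U : Set (ℤ → Fin M)) : Monotone (cylinderInterior U) :=
  fun m n hmn _ hx y hy => hx y fun i h1 h2 => hy i (by lia) (by lia)

lemma iUnion_cylinderInterior {U : Set (ℤ → Fin M)} (hU : IsOpen U) :
    ⋃ m, cylinderInterior U m = U := by
  refine Subset.antisymm (iUnion_subset fun m x hx => hx x fun _ _ _ => rfl) fun x hx => ?_
  obtain ⟨I, s, hs, hsub⟩ := isOpen_pi_iff.1 hU x hx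
  refine mem_iUnion.2 ⟨I.sup Int.natAbs, fun y hy => hsub fun i hi => ?_⟩
  have : i.natAbs ≤ I.sup Int.natAbs := Finset.le_sup (f := Int.natAbs) hi
  rw [hy i (by lia) (by lia)]
  exact (hs i hi).2

lemma cylinderInterior_eq (U : Set (ℤ → Fin M)) (m : ℕ) :
    cylinderInterior U m =
      ⋃ w ∈ {w : Fin (2 * m + 1) → Fin M | cylinderAt (-m) w ⊆ U}, cylinderAt (-m) w := by
  ext x
  simp only [mem_iUnion, mem_ofPred_eq, exists_prop]
  constructor
  · intro hx
    refine ⟨fun j => x (-m + (j : ℕ)), fun y hy => hx y fun i h1 h2 => ?_, fun j => rfl⟩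
    have e : -(m : ℤ) + ((i + m).toNat : ℤ) = i := by lia
    have := hy ⟨(i + m).toNat, by lia⟩
    simp only [e] at this
    exact this
  · rintro ⟨w, hw, hx⟩ y hy
    refine hw fun j => ?_
    rw [hy _ (by lia) (by have := j.2; lia), hx j]

/-- A measure whose cylinder weights are dominated by those of `μ` is absolutely continuous. -/
lemma absolutelyContinuous_of_cylinderAt_le [IsFiniteMeasure μ] [IsFiniteMeasure ν] {C : ℝ}
    (hC : 0 < C) (h : ∀ (m : ℕ) (w : Fin (2 * m + 1) → Fin M),
      ν.real (cylinderAt (-m) w) ≤ C * μ.real (cylinderAt (-m) w)) : ν ≪ μ := by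
  classical
  -- The bound passes from cylinders to finite disjoint unions of them, then to open sets as
  -- increasing unions of these.
  have hint : ∀ (U : Set (ℤ → Fin M)) m,
      ν (cylinderInterior U m) ≤ ENNReal.ofReal C * μ (cylinderInterior U m) := by
    intro U m
    have hsum : ∀ (η : Measure (ℤ → Fin M)) [IsFiniteMeasure η], η (cylinderInterior U m) =
        ∑ w ∈ Finset.univ.filter fun w : Fin (2 * m + 1) → Fin M => cylinderAt (-m) w ⊆ U,
          η (cylinderAt (-m) w) := by
      intro η _
      rw [cylinderInterior_eq, ← measure_biUnion_finset
        (fun w _ w' _ hne => pairwise_disjoint_cylinderAt M (-m) (2 * m + 1) hne)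
        (fun w _ => measurableSet_cylinderAt _ w)]
      simp
    rw [hsum ν, hsum μ, Finset.mul_sum]
    refine Finset.sum_le_sum fun w _ => ?_
    rw [← ofReal_measureReal (μ := ν), ← ofReal_measureReal (μ := μ), ← ENNReal.ofReal_mul hC.le]
    exact ENNReal.ofReal_le_ofReal (h m w)
  have hopen : ∀ U : Set (ℤ → Fin M), IsOpen U → ν U ≤ ENNReal.ofReal C * μ U := by
    intro U hU
    have h1 := tendsto_measure_iUnion_atTop (μ := ν) (monotone_cylinderInterior U)
    rw [iUnion_cylinderInterior hU] at h1
    refine le_of_tendsto' h1 fun m => (hint U m).trans ?_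
    gcongr
    conv_rhs => rw [← iUnion_cylinderInterior hU]
    exact subset_iUnion _ m
  refine Measure.AbsolutelyContinuous.mk fun s _ hs => ?_
  by_contra hne
  have hC' : ENNReal.ofReal C ≠ 0 := by simpa using hC
  -- Outer regularity encloses the μ-null set in an open U so small that C μ(U) < ν(s).
  obtain ⟨U, hsU, hU, hlt⟩ := s.exists_isOpen_lt_of_lt (μ := μ) (ν s / ENNReal.ofReal C)
    (by rw [hs]; exact ENNReal.div_pos hne ENNReal.ofReal_ne_top)
  have h1 : ENNReal.ofReal C * μ U < ν s := ENNReal.mul_lt_of_lt_div' hlt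
  exact lt_irrefl _ (((measure_mono hsU).trans (hopen U hU)).trans_lt h1)

/-- The Gibbs inequality concerns cylinders at place 0, whereas approximating open sets needs
windows around 0; invariance bridges the two. -/
lemma measureReal_cylinderAt_neg (hν : MeasurePreserving shift ν ν) (m : ℕ) {n : ℕ}
    (w : Fin n → Fin M) : ν.real (cylinderAt (-m) w) = ν.real (wordCylinder w) := by
  rw [wordCylinder_eq_cylinderAt, ← (hν.iterate m).measureReal_preimage
    (measurableSet_cylinderAt (-m) w).nullMeasurableSet, preimage_shift_cylinderAt, neg_add_cancel]

/-- A Gibbs state that is ergodic is the only Gibbs state. -/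
lemma IsGibbsStateWith.eq_of_ergodic {A : Fin M → Matrix (Fin d) (Fin d) ℝ} {t P Q : ℝ}
    (hν : IsGibbsStateWith A t P ν) (hμ : IsGibbsStateWith A t Q μ) (herg : Ergodic shift μ) :
    ν = μ ∧ P = Q := by
  have hPQ : P = Q := le_antisymm (hμ.constant_le hν) (hν.constant_le hμ)
  refine ⟨?_, hPQ⟩
  subst hPQ
  obtain ⟨hν1, hν2, C, hC, h⟩ := hν
  obtain ⟨hμ1, hμ2, D, hD, h'⟩ := hμ
  refine herg.eq_of_absolutelyContinuous hν2
    (absolutelyContinuous_of_cylinderAt_le (C := C * D) (by positivity) fun m w => ?_)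
  rw [measureReal_cylinderAt_neg hν2, measureReal_cylinderAt_neg hμ2, mul_assoc,
    ← inv_mul_le_iff₀ hC]
  exact (h _ (by lia) w).1.trans (h' _ (by lia) w).2

/-! ### Mixing estimates -/

/-- Correlations of cylinders in terms of the convergence of the powers of the total matrix. -/
lemma HasBoxWeights.exists_sum_correlation_le (hμ : HasBoxWeights N u v μ)
    [IsProbabilityMeasure μ] (hN : PerronData K (∑ i, N i) 1 u v) (hnn : ∀ i, KNonneg K (N i)) :
    ∃ C : ℝ, 0 < C ∧ ∀ (δ : ℝ) (g : ℕ), 0 ≤ δ →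
      (∀ x, ‖(∑ i, N i) ^ g *ᵥ x - (x ⬝ᵥ v) • u‖ ≤ δ * ‖x‖) → ∀ (a : ℤ) (p q : ℕ),
      ∑ w : Fin p → Fin M, ∑ z : Fin q → Fin M,
        |μ.real (MatrixGibbs.cylinderAt a w ∩ MatrixGibbs.cylinderAt (a + p + g) z) -
          μ.real (MatrixGibbs.cylinderAt a w) *
            μ.real (MatrixGibbs.cylinderAt (a + p + g) z)| ≤ C * δ := by
  -- With u dominating the norm on the dual cone and v on K, the error for a pair of words is at
  -- most a multiple of δ times the product of their measures. Summing over all words therefore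
  -- costs no factor.
  have hupos : StrictlyPositiveOn (dualCone K) u := fun w hw hne => by
    rw [dotProduct_comm]
    exact dotProduct_pos_of_mem_interior hN.isCone hN.mem_interior hw hne
  obtain ⟨C₁, hC₁, h₁⟩ := hN.pos.exists_norm_le hN.isCone hN.isClosed
  obtain ⟨C₂, hC₂, h₂⟩ := hupos.exists_norm_le (isCone_dualCone hN.isCone hN.mem_interior)
    (isClosed_dualCone K)
  refine ⟨d * C₁ * C₂ + 1, by positivity, fun δ g hδ hg a p q => ?_⟩
  have hterm : ∀ (w : Fin p → Fin M) (z : Fin q → Fin M),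
      |μ.real (MatrixGibbs.cylinderAt a w ∩ MatrixGibbs.cylinderAt (a + p + g) z) -
        μ.real (MatrixGibbs.cylinderAt a w) * μ.real (MatrixGibbs.cylinderAt (a + p + g) z)| ≤
      d * C₁ * C₂ * δ * (μ.real (MatrixGibbs.cylinderAt a w) *
        μ.real (MatrixGibbs.cylinderAt (a + p + g) z)) := by
    intro w z
    rw [hμ.inter_cylinderAt, hμ.cylinderAt, hμ.cylinderAt]
    have hw := KNonneg.wordProd hnn w
    have hz := KNonneg.wordProd hnn z
    set y := wordProd N z *ᵥ u
    have hyK : y ∈ K := hz u (interior_subset hN.mem_interior)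
    have e1 : (wordProd N w *ᵥ ((∑ i, N i) ^ g *ᵥ y)) ⬝ᵥ v - (wordProd N w *ᵥ u) ⬝ᵥ v * (y ⬝ᵥ v) =
        ((∑ i, N i) ^ g *ᵥ y - (y ⬝ᵥ v) • u) ⬝ᵥ ((wordProd N w)ᵀ *ᵥ v) := by
      rw [dotProduct_transpose_mulVec, mulVec_sub, mulVec_smul, sub_dotProduct, smul_dotProduct,
        smul_eq_mul, mul_comm (y ⬝ᵥ v)]
    have e2 : ‖(wordProd N w)ᵀ *ᵥ v‖ ≤ C₂ * ((wordProd N w *ᵥ u) ⬝ᵥ v) := by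
      have := h₂ _ (hw.transpose v hN.pos.mem_dualCone)
      rwa [dotProduct_comm, dotProduct_transpose_mulVec] at this
    have e3 : ‖(∑ i, N i) ^ g *ᵥ y - (y ⬝ᵥ v) • u‖ ≤ δ * (C₁ * (y ⬝ᵥ v)) :=
      (hg y).trans (mul_le_mul_of_nonneg_left (h₁ y hyK) hδ)
    rw [e1]
    have hyv := hN.pos.nonneg hyK
    calc _ ≤ d * ‖(∑ i, N i) ^ g *ᵥ y - (y ⬝ᵥ v) • u‖ * ‖(wordProd N w)ᵀ *ᵥ v‖ :=
          abs_dotProduct_le _ _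
      _ ≤ d * (δ * (C₁ * (y ⬝ᵥ v))) * (C₂ * ((wordProd N w *ᵥ u) ⬝ᵥ v)) := by gcongr
      _ = _ := by ring
  refine (Finset.sum_le_sum fun w _ => Finset.sum_le_sum fun z _ => hterm w z).trans ?_
  simp only [← Finset.mul_sum]
  rw [sum_measureReal_cylinderAt, ← Finset.sum_mul, sum_measureReal_cylinderAt, one_mul, mul_one]
  gcongr
  linarith

lemma joinPartition_eq_cylinderAt (a n : ℕ) (w : Fin n → Fin M) :
    joinPartition shift (fun i : Fin M => {x : ℤ → Fin M | x 0 = i}) a n w = cylinderAt a w := by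
  ext x
  simp [joinPartition, cylinderAt, shift_iterate_apply]

/-- The summed correlation bound depends on the gap t − s only, not on the lengths of the two
blocks. -/
lemma HasBoxWeights.isWeakBernoulli (hμ : HasBoxWeights N u v μ) [IsProbabilityMeasure μ]
    (hN : PerronData K (∑ i, N i) 1 u v) (hnn : ∀ i, KNonneg K (N i)) {D κ : ℝ} (hD : 0 < D)
    (hκ0 : 0 < κ) (hκ : κ < 1)
    (hpow : ∀ (g : ℕ) x, ‖(∑ i, N i) ^ g *ᵥ x - (x ⬝ᵥ v) • u‖ ≤ D * κ ^ g * ‖x‖) :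
    IsWeakBernoulli μ := by
  obtain ⟨C, hC, h⟩ := hμ.exists_sum_correlation_le hN hnn
  intro ε hε
  have hlim : Tendsto (fun g : ℕ => C * (D * κ ^ g)) atTop (𝓝 (C * (D * 0))) :=
    ((tendsto_pow_atTop_nhds_zero_of_lt_one hκ0.le hκ).const_mul D).const_mul C
  rw [mul_zero, mul_zero] at hlim
  obtain ⟨G, hG⟩ := eventually_atTop.1 (hlim.eventually_lt_const hε)
  refine ⟨G, fun r s t hst => ?_⟩
  obtain ⟨g, rfl⟩ : ∃ g, t = s + g := ⟨t - s, by lia⟩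
  have h1 := h (D * κ ^ g) g (by positivity) (hpow g) 0 s r
  rw [EpsIndependent]
  simp only [joinPartition_eq_cylinderAt]
  refine lt_of_le_of_lt ?_ (hG g (by lia))
  simpa using h1

end MatrixGibbs

namespace MatrixGibbs

open Set Filter Topology Matrix MeasureTheory

variable {d M : ℕ} {K : Set (Fin d → ℝ)} {N : Fin M → Matrix (Fin d) (Fin d) ℝ}
  {u v : Fin d → ℝ} {μ : Measure (ℤ → Fin M)}

/-! ### Decay of correlations -/

/-- The least Hölder constant. -/
noncomputable def holderSeminorm (θ : ℝ) (f : C(ℤ → Fin M, ℝ)) : ℝ := sInf (holderConstants θ f)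

lemma holderSeminorm_nonneg (θ : ℝ) (f : C(ℤ → Fin M, ℝ)) : 0 ≤ holderSeminorm θ f :=
  Real.sInf_nonneg fun _ hL => hL.1

/-- The supremum in `variation` runs over a set bounded by 2‖f‖, and the infimum of the admissible
constants is itself admissible. -/
lemma abs_sub_le_holderSeminorm {θ : ℝ} (hθ : 0 < θ) {f : C(ℤ → Fin M, ℝ)} (hf : IsHolder θ f)
    (n : ℕ) {x y : ℤ → Fin M} (hxy : ∀ i : ℤ, |i| ≤ (n : ℤ) - 1 → x i = y i) :
    |f x - f y| ≤ holderSeminorm θ f * θ ^ n := by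
  have h1 : |f x - f y| ≤ variation f n := by
    refine le_csSup ⟨‖f‖ + ‖f‖, ?_⟩ ⟨x, y, hxy, rfl⟩
    rintro _ ⟨x, y, -, rfl⟩
    exact (abs_sub _ _).trans (add_le_add (f.norm_coe_le_norm x) (f.norm_coe_le_norm y))
  rw [← div_le_iff₀ (by positivity)]
  refine le_csInf hf fun L hL => ?_
  rw [div_le_iff₀ (by positivity)]
  exact h1.trans (hL.2 n)

/-- The word of `x` in the window `[-m, m)`. -/
def windowWord (m : ℕ) (x : ℤ → Fin M) : Fin (2 * m) → Fin M := fun j => x (-m + (j : ℕ))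

/-- Replace `x` by a constant outside the window `[-m, m)`. -/
def truncate (c : Fin M) (m : ℕ) (x : ℤ → Fin M) : ℤ → Fin M := extendWord c m (windowWord m x)

lemma truncate_apply (c : Fin M) {m : ℕ} (x : ℤ → Fin M) {i : ℤ} (h : |i| ≤ (m : ℤ) - 1) :
    x i = truncate c m x i := by
  rw [abs_le] at h
  have e : -(m : ℤ) + ((i + m).toNat : ℤ) = i := by lia
  rw [truncate, extendWord, dif_pos (by lia)]
  simp only [windowWord, e]

lemma measurable_windowWord (m : ℕ) : Measurable (windowWord m : (ℤ → Fin M) → _) :=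
  measurable_pi_lambda _ fun _ => measurable_pi_apply _

lemma windowWord_preimage (m : ℕ) (w : Fin (2 * m) → Fin M) :
    windowWord m ⁻¹' {w} = cylinderAt (-m) w := by
  ext x
  simp [windowWord, cylinderAt, funext_iff]

lemma integral_comp_fintype {X ι : Type*} [MeasurableSpace X] [Fintype ι] [MeasurableSpace ι]
    [MeasurableSingletonClass ι] {η : Measure X} [IsFiniteMeasure η] {φ : X → ι}
    (hφ : Measurable φ) (h : ι → ℝ) : ∫ x, h (φ x) ∂η = ∑ i, η.real (φ ⁻¹' {i}) * h i := by
  have : IsFiniteMeasure (η.map φ) := Measure.isFiniteMeasure_map η φ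
  have hm : Measurable h := measurable_of_finite h
  rw [← integral_map hφ.aemeasurable hm.aestronglyMeasurable,
    integral_fintype .of_finite]
  refine Finset.sum_congr rfl fun i _ => ?_
  rw [map_measureReal_apply hφ (measurableSet_singleton i), smul_eq_mul]

/-- Correlations of functions that depend on a window only. -/
lemma HasBoxWeights.truncated_correlation_le (hμ : HasBoxWeights N u v μ) [IsProbabilityMeasure μ]
    (m g : ℕ) {b : ℝ}
    (hb : ∑ w : Fin (2 * m) → Fin M, ∑ z : Fin (2 * m) → Fin M,
      |μ.real (MatrixGibbs.cylinderAt (-m) w ∩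
          MatrixGibbs.cylinderAt (-m + (2 * m : ℕ) + g) z) -
        μ.real (MatrixGibbs.cylinderAt (-m) w) *
          μ.real (MatrixGibbs.cylinderAt (-m + (2 * m : ℕ) + g) z)| ≤ b)
    {F G : (Fin (2 * m) → Fin M) → ℝ} {s t : ℝ} (hs : 0 ≤ s) (ht : 0 ≤ t)
    (hF : ∀ w, |F w| ≤ s) (hG : ∀ w, |G w| ≤ t) :
    |∫ x, F (windowWord m x) * G (windowWord m (shift^[2 * m + g] x)) ∂μ -
      (∫ x, F (windowWord m x) ∂μ) * ∫ x, G (windowWord m x) ∂μ| ≤ s * t * b := by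
  have hφ := measurable_windowWord (M := M) m
  have hsh : Measurable (shift^[2 * m + g] : (ℤ → Fin M) → _) := measurable_shift.iterate _
  have e1 := integral_comp_fintype (η := μ) (hφ.prodMk (hφ.comp hsh)) fun i => F i.1 * G i.2
  simp only [Function.comp_apply] at e1
  have hpre : ∀ w z : Fin (2 * m) → Fin M,
      (fun x => (windowWord m x, windowWord m (shift^[2 * m + g] x))) ⁻¹' {(w, z)} =
      MatrixGibbs.cylinderAt (-m) w ∩ MatrixGibbs.cylinderAt (-m + (2 * m : ℕ) + g) z := by
    intro w z
    have : MatrixGibbs.cylinderAt (-m + (2 * m : ℕ) + g) z =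
        shift^[2 * m + g] ⁻¹' (windowWord m ⁻¹' {z}) := by
      rw [windowWord_preimage, preimage_shift_cylinderAt, add_assoc, Nat.cast_add]
    rw [this, ← windowWord_preimage]
    ext x
    simp
  rw [e1, Fintype.sum_prod_type, integral_comp_fintype hφ, integral_comp_fintype hφ]
  simp only [hpre, windowWord_preimage]
  -- Cylinder measures do not depend on the place, so the second mean can be read in the shifted
  -- window.
  have e2 : ∑ z : Fin (2 * m) → Fin M, μ.real (MatrixGibbs.cylinderAt (-m) z) * G z =
      ∑ z : Fin (2 * m) → Fin M,
        μ.real (MatrixGibbs.cylinderAt (-m + (2 * m : ℕ) + g) z) * G z :=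
    Finset.sum_congr rfl fun z _ => by rw [hμ.cylinderAt, hμ.cylinderAt]
  rw [e2, Finset.sum_mul_sum, ← Finset.sum_sub_distrib]
  simp only [← Finset.sum_sub_distrib]
  refine (Finset.abs_sum_le_sum_abs _ _).trans ?_
  refine (Finset.sum_le_sum fun w _ => Finset.abs_sum_le_sum_abs _ _).trans ?_
  refine le_trans ?_ (mul_le_mul_of_nonneg_left hb (mul_nonneg hs ht))
  rw [Finset.mul_sum]
  refine Finset.sum_le_sum fun w _ => ?_
  rw [Finset.mul_sum]
  refine Finset.sum_le_sum fun z _ => ?_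
  rw [mul_mul_mul_comm, mul_comm, mul_comm _ (F w * G z), ← mul_sub, abs_mul, abs_mul]
  gcongr
  · exact hF w
  · exact hG z

/-- The difference of the correlations of two pairs of uniformly close functions. -/
lemma abs_correlation_sub_le {X : Type*} [MeasurableSpace X] {η : Measure X}
    [IsProbabilityMeasure η] {f f' g g' h h' : X → ℝ} (hf : Measurable f) (hf' : Measurable f')
    (hg : Measurable g) (hg' : Measurable g') (hh : Measurable h) (hh' : Measurable h')
    {a b s t : ℝ}
    (hfa : ∀ x, |f x| ≤ a) (hfa' : ∀ x, |f' x| ≤ a) (hgb : ∀ x, |g x| ≤ b)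
    (hgb' : ∀ x, |g' x| ≤ b) (hhb : ∀ x, |h x| ≤ b) (hhb' : ∀ x, |h' x| ≤ b)
    (hfs : ∀ x, |f x - f' x| ≤ s) (hgt : ∀ x, |g x - g' x| ≤ t) (hht : ∀ x, |h x - h' x| ≤ t) :
    |(∫ x, f x * g x ∂η - (∫ x, f x ∂η) * ∫ x, h x ∂η) -
      (∫ x, f' x * g' x ∂η - (∫ x, f' x ∂η) * ∫ x, h' x ∂η)| ≤ 2 * (s * b + a * t) := by
  have hint : ∀ {k : X → ℝ} {c : ℝ}, Measurable k → (∀ x, |k x| ≤ c) → Integrable k η :=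
    fun hk hc => .of_bound hk.aestronglyMeasurable _ (Eventually.of_forall hc)
  have hbd : ∀ {k : X → ℝ} {c : ℝ}, (∀ x, |k x| ≤ c) → |∫ x, k x ∂η| ≤ c := fun {k c} hc => by
    simpa using norm_integral_le_of_norm_le_const (μ := η) (f := k) (Eventually.of_forall hc)
  obtain ⟨x₀⟩ : Nonempty X := η.nonempty_of_neZero
  have ha : 0 ≤ a := (abs_nonneg _).trans (hfa x₀)
  have hb : 0 ≤ b := (abs_nonneg _).trans (hgb x₀)
  have hs : 0 ≤ s := (abs_nonneg _).trans (hfs x₀)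
  have ht : 0 ≤ t := (abs_nonneg _).trans (hgt x₀)
  have hprod : ∀ {p p' q q' : ℝ}, |p'| ≤ a → |q| ≤ b → |p - p'| ≤ s → |q - q'| ≤ t →
      |p * q - p' * q'| ≤ s * b + a * t := by
    intro p p' q q' h1 h2 h3 h4
    rw [show p * q - p' * q' = (p - p') * q + p' * (q - q') by ring]
    refine (abs_add_le _ _).trans (add_le_add ?_ ?_) <;> rw [abs_mul] <;> gcongr
  have hfg : ∀ x, |f x * g x| ≤ a * b := fun x => by
    rw [abs_mul]; exact mul_le_mul (hfa x) (hgb x) (abs_nonneg _) ha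
  have hfg' : ∀ x, |f' x * g' x| ≤ a * b := fun x => by
    rw [abs_mul]; exact mul_le_mul (hfa' x) (hgb' x) (abs_nonneg _) ha
  have e1 : |∫ x, f x * g x ∂η - ∫ x, f' x * g' x ∂η| ≤ s * b + a * t := by
    rw [← integral_sub (f := fun x => f x * g x) (g := fun x => f' x * g' x)
      (hint (hf.mul hg) hfg) (hint (hf'.mul hg') hfg')]
    exact hbd fun x => hprod (hfa' x) (hgb x) (hfs x) (hgt x)
  have e2 : |∫ x, f x ∂η - ∫ x, f' x ∂η| ≤ s := by
    rw [← integral_sub (hint hf hfa) (hint hf' hfa')]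
    exact hbd hfs
  have e3 : |∫ x, h x ∂η - ∫ x, h' x ∂η| ≤ t := by
    rw [← integral_sub (hint hh hhb) (hint hh' hhb')]
    exact hbd hht
  have e4 := hprod (hbd hfa') (hbd hhb) e2 e3
  rw [abs_le] at e1 e4 ⊢
  constructor <;> linarith [e1.1, e1.2, e4.1, e4.2]

/-- Truncate both functions to the window [−m, m) with m = n / 3, at a cost of order θ^m. After the
shift by n the windows are k ≥ m places apart, so the truncated correlation is of order κ^k. The
condition γ³ = max θ κ bounds both by γ^{3m}. -/
lemma HasBoxWeights.hasDecayOfCorrelations (hμ : HasBoxWeights N u v μ) [IsProbabilityMeasure μ]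
    (hN : PerronData K (∑ i, N i) 1 u v) (hnn : ∀ i, KNonneg K (N i)) (c : Fin M)
    {D κ θ γ : ℝ} (hD : 0 < D) (hκ0 : 0 < κ) (hκ : κ < 1) (hθ0 : 0 < θ) (hγ0 : 0 < γ)
    (hγ1 : γ < 1) (hγ : γ ^ 3 = max θ κ)
    (hpow : ∀ (g : ℕ) x, ‖(∑ i, N i) ^ g *ᵥ x - (x ⬝ᵥ v) • u‖ ≤ D * κ ^ g * ‖x‖) :
    HasDecayOfCorrelations μ θ γ := by
  obtain ⟨C, hC, h⟩ := hμ.exists_sum_correlation_le hN hnn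
  refine ⟨(2 + C * D) / γ ^ 2, fun f g hf hg n => ?_⟩
  set m := n / 3 with hm
  obtain ⟨k, hk, hmk⟩ : ∃ k, n = 2 * m + k ∧ m ≤ k := ⟨n - 2 * m, by lia, by lia⟩
  set a := ‖f‖
  set b := ‖g‖
  set s := holderSeminorm θ f with hs
  set t := holderSeminorm θ g with ht
  have ha : 0 ≤ a := norm_nonneg _
  have hb : 0 ≤ b := norm_nonneg _
  have hs0 : 0 ≤ s := holderSeminorm_nonneg θ f
  have ht0 : 0 ≤ t := holderSeminorm_nonneg θ g
  have hfm : Measurable f := f.continuous.measurable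
  have hgm : Measurable g := g.continuous.measurable
  have hsh : Measurable (shift^[n] : (ℤ → Fin M) → _) := measurable_shift.iterate _
  have htr : Measurable (truncate c m : (ℤ → Fin M) → _) :=
    (measurable_of_finite (extendWord c m)).comp (measurable_windowWord m)
  have hclose : ∀ {k : C(ℤ → Fin M, ℝ)}, IsHolder θ k → ∀ x,
      |k x - k (truncate c m x)| ≤ holderSeminorm θ k * θ ^ m := fun hk x =>
    abs_sub_le_holderSeminorm hθ0 hk m fun i hi => truncate_apply c x hi
  have h1 := abs_correlation_sub_le (η := μ) hfm (hfm.comp htr) (hgm.comp hsh)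
    (hgm.comp (htr.comp hsh)) hgm (hgm.comp htr)
    (fun x => f.norm_coe_le_norm x) (fun x => f.norm_coe_le_norm _)
    (fun x => g.norm_coe_le_norm _) (fun x => g.norm_coe_le_norm _)
    (fun x => g.norm_coe_le_norm _) (fun x => g.norm_coe_le_norm _)
    (fun x => hclose hf x) (fun x => hclose hg (shift^[n] x)) (fun x => hclose hg x)
  have h2 := hμ.truncated_correlation_le m k (h (D * κ ^ k) k (by positivity) (hpow k) (-m) _ _)
    ha hb (F := fun w => f (extendWord c m w)) (G := fun w => g (extendWord c m w))
    (fun w => f.norm_coe_le_norm _) (fun w => g.norm_coe_le_norm _)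
  rw [← hk] at h2
  simp only [Function.comp_apply] at h1
  set X := ∫ x, f x * g (shift^[n] x) ∂μ - (∫ x, f x ∂μ) * ∫ x, g x ∂μ
  set Y := ∫ x, f (truncate c m x) * g (truncate c m (shift^[n] x)) ∂μ -
    (∫ x, f (truncate c m x) ∂μ) * ∫ x, g (truncate c m x) ∂μ
  have h3 : |Y| ≤ a * b * (C * (D * κ ^ k)) := h2
  have hθm : θ ^ m ≤ γ ^ (3 * m) := by
    rw [pow_mul, hγ]; exact pow_le_pow_left₀ hθ0.le (le_max_left _ _) m
  have hκm : κ ^ k ≤ γ ^ (3 * m) := by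
    rw [pow_mul, hγ]
    exact (pow_le_pow_of_le_one hκ0.le hκ.le hmk).trans
      (pow_le_pow_left₀ hκ0.le (le_max_right _ _) m)
  -- Rounding in n / 3 loses at most two steps, hence the γ² in the constant.
  have hγm : γ ^ (3 * m) ≤ γ ^ n / γ ^ 2 := by
    rw [le_div_iff₀ (by positivity), ← pow_add]
    exact pow_le_pow_of_le_one hγ0.le hγ1.le (by lia)
  have hnorm : holderNorm θ f * holderNorm θ g = (a + s) * (b + t) := rfl
  calc |X| ≤ |X - Y| + |Y| := by simpa using abs_add_le (X - Y) Y
    _ ≤ 2 * (s * θ ^ m * b + a * (t * θ ^ m)) + a * b * (C * (D * κ ^ k)) := add_le_add h1 h3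
    _ ≤ 2 * (s * γ ^ (3 * m) * b + a * (t * γ ^ (3 * m))) + a * b * (C * (D * γ ^ (3 * m))) := by
        gcongr
    _ = (2 * (s * b + a * t) + C * D * (a * b)) * γ ^ (3 * m) := by ring
    _ ≤ (2 * ((a + s) * (b + t)) + C * D * ((a + s) * (b + t))) * γ ^ (3 * m) := by
        gcongr
        · nlinarith [mul_nonneg ha hb, mul_nonneg hs0 ht0]
        · linarith
        · linarith
    _ = (2 + C * D) * ((a + s) * (b + t)) * γ ^ (3 * m) := by ring
    _ ≤ (2 + C * D) * ((a + s) * (b + t)) * (γ ^ n / γ ^ 2) := by gcongr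
    _ = (2 + C * D) / γ ^ 2 * holderNorm θ f * holderNorm θ g * γ ^ n := by
        rw [mul_assoc _ (holderNorm θ f), hnorm]; ring

/-- The rate of decay of correlations for Hölder functions of exponent `θ`. -/
noncomputable def correlationRate (θ : ℝ) (S : Set ℂ) : ℝ :=
  max θ (mixingRate S) ^ (1 / 3 : ℝ)

end MatrixGibbs

/-! ### The main theorem, by normalisation with the Perron eigenvalue -/

theorem theorem2 :
    ∃ Γ : ℝ → Set ℂ → ℝ,
      ∀ (d M : ℕ) (A : Fin M → Matrix (Fin d) (Fin d) ℝ) (K : Set (Fin d → ℝ)),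
        IsCone K → IsClosed K → K ≠ {0} →
        (∀ i, KNonneg K (A i)) → KIrreducible K (∑ i, A i) → (∑ i, A i) ≠ 0 →
        (∃ u v, IsPerronPair (∑ i, A i) u v) ∧
        ∃ μ : Measure (ℤ → Fin M),
          (∀ u v, IsPerronPair (∑ i, A i) u v → ∀ (n : ℕ) (w : Fin n → Fin M),
            μ.real (wordCylinder w) =
              (specRad (∑ i, A i) ^ n)⁻¹ * ((wordProd A w).mulVec u ⬝ᵥ v)) ∧
          IsGibbsStateWith A 1 (Real.log (specRad (∑ i, A i))) μ ∧
          Ergodic shift μ ∧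
          (∀ (ν : Measure (ℤ → Fin M)) (P : ℝ), IsGibbsStateWith A 1 P ν →
            ν = μ ∧ P = Real.log (specRad (∑ i, A i))) ∧
          (KPrimitive K (∑ i, A i) →
            IsWeakBernoulli μ ∧
            ∀ θ : ℝ, 0 < θ → θ < 1 →
              0 < Γ θ (eigenvalues (∑ i, A i)) ∧ Γ θ (eigenvalues (∑ i, A i)) < 1 ∧
              HasDecayOfCorrelations μ θ (Γ θ (eigenvalues (∑ i, A i)))) := by
  refine ⟨correlationRate, fun d M A K hK hcl hne hA hirr hA0 => ?_⟩
  obtain ⟨r, hr, u, hu, v, hv, hru, hrv, huv⟩ := hirr.exists_perron hK hcl hne hA0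
  have hP : PerronData K (∑ i, A i) r u v := ⟨hK, hcl, hirr.1, hu, hv, hru, hrv, huv⟩
  have hrad : specRad (∑ i, A i) = r := hP.specRad_eq hr.le
  -- The letter c fills the places outside finite windows; it exists because an empty sum would
  -- vanish.
  obtain ⟨c⟩ : Nonempty (Fin M) := by
    by_contra hcon
    rw [not_nonempty_iff] at hcon
    exact hA0 (by simp)
  have hnn : ∀ i, KNonneg K (r⁻¹ • A i) := fun i x hx => by
    rw [Matrix.smul_mulVec]
    exact hK.smul_mem (by positivity) (hA i x hx)
  have hsum : ∑ i, r⁻¹ • A i = r⁻¹ • ∑ i, A i := Finset.smul_sum.symm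
  have hN : PerronData K (∑ i, r⁻¹ • A i) 1 u v := by rw [hsum]; exact hP.inv_smul hr
  obtain ⟨μ, hprob, hμ⟩ := exists_measure_box hN hnn c
  replace hμ : HasBoxWeights (fun i => r⁻¹ • A i) u v μ := hμ
  have hcyl : ∀ (n : ℕ) (w : Fin n → Fin M),
      μ.real (wordCylinder w) = (r ^ n)⁻¹ * ((wordProd A w).mulVec u ⬝ᵥ v) := fun n w => by
    rw [wordCylinder_eq_cylinderAt, hμ.cylinderAt, wordProd_smul, Matrix.smul_mulVec,
      smul_dotProduct, inv_pow, smul_eq_mul]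
  have herg : Ergodic shift μ := hμ.ergodic fun x => by
    rw [hsum]; exact hP.tendsto_cesaro_of_irreducible hr hirr x
  have hgibbs : IsGibbsStateWith A 1 (Real.log r) μ := by
    refine ⟨hprob, hμ.measurePreserving, ?_⟩
    obtain ⟨C, hC, h⟩ := exists_opNorm_comparison hK hcl hu hv
    refine ⟨C, hC, fun n _ w => ?_⟩
    have hexp : Real.exp (-(n * Real.log r)) = (r ^ n)⁻¹ := by
      rw [Real.exp_neg, Real.exp_nat_mul, Real.exp_log hr]
    obtain ⟨h1, h2⟩ := h _ (KNonneg.wordProd hA w)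
    rw [hcyl, hexp, Real.rpow_one, mul_left_comm, mul_left_comm C]
    exact ⟨mul_le_mul_of_nonneg_left h1 (by positivity),
      mul_le_mul_of_nonneg_left h2 (by positivity)⟩
  rw [hrad]
  refine ⟨⟨u, v, by rw [hrad]; exact hru, by rw [hrad]; exact hrv, huv⟩, μ, ?_, hgibbs, herg,
    fun ν P hν => hν.eq_of_ergodic hgibbs herg, fun hprim => ?_⟩
  · rintro u' v' ⟨h1, h2, h3⟩ n w
    rw [hrad] at h1 h2
    rw [hcyl, hP.perronPair_dotProduct hr hirr h1 h2 h3]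
  · obtain ⟨D, hD, hpow⟩ := hP.exists_pow_sub_le hr hirr hprim
    rw [← hsum] at hpow
    have hκ0 := hP.mixingRate_pos hr
    have hκ1 := hP.mixingRate_lt_one hr hprim
    refine ⟨hμ.isWeakBernoulli hN hnn hD hκ0 hκ1 hpow, fun θ hθ0 hθ1 => ?_⟩
    have hm0 : 0 < max θ (mixingRate (eigenvalues (∑ i, A i))) := lt_max_of_lt_left hθ0
    have h0 : 0 < correlationRate θ (eigenvalues (∑ i, A i)) := Real.rpow_pos_of_pos hm0 _
    have h1 : correlationRate θ (eigenvalues (∑ i, A i)) < 1 :=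
      Real.rpow_lt_one hm0.le (max_lt hθ1 hκ1) (by norm_num)
    refine ⟨h0, h1, hμ.hasDecayOfCorrelations hN hnn c hD hκ0 hκ1 hθ0 h0 h1 ?_ hpow⟩
    rw [correlationRate, ← Real.rpow_mul_natCast hm0.le]
    norm_num
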